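/- Let $N\ge 1$, let $\Omega\subset\mathbb R^N$ be a bounded domain (nonempty, open, connected) with $C^\infty$ boundary, let $T>0$ and $Q_T=\Omega\times(0,T)$. Let $\alpha,l,\sigma>0$, $\beta,\nu\ge 0$, $\gamma,\mu\in\mathbb R$, $r\ge p-1\ge \frac p2$, $q\ge\frac p2$ and $k,m,s\ge 1$ be real numbers, and let $u_0\in W^{1,\infty}(\Omega)$ with $u_0\ge 0$, $u_0\not\equiv 0$. Consider the problem $$\partial_t u-\operatorname{div}(|\nabla u|^{p-2}\nabla u)=\alpha|u|^{k-1}u\int_\Omega|u|^s\,dx-\beta|u|^{l-1}u|\nabla u|^q+\gamma u^m+\mu|\nabla u|^r-\nu|u|^{\sigma-1}u\quad\text{in }Q_T,\qquad(1)$$ with $u=0$ on $\partial\Omega\times(0,T)$ and $u(\cdot,0)=u_0$ in $\Omega$. Put $\tilde\alpha=\max\{p,k+s,l+q,m,r,\sigma\}$. A nonnegative function $u$ is called a weak sub-solution (respectively super-solution) of (1) on $Q_T$ if (i) $u\in C([0,T)\times\overline\Omega)\cap L^{\tilde\alpha}(0,T;W^{1,\tilde\alpha}_0(\Omega))$ and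 its weak time derivative satisfies $\partial_t u\in L^2(Q_T)$; (ii) for every nonnegative $\phi\in C(\overline{Q_T})\cap L^p(0,T;W^{1,p}_0(\Omega))$, $$\int_{Q_T}\big(\partial_t u\,\phi+|\nabla u|^{p-2}\nabla u\cdot\nabla\phi\big)\,dx\,dt\ \le\ (\text{resp. }\ge)\ \int_{Q_T}\Big(\alpha|u|^{k-1}u\int_\Omega|u|^s\,dx-\beta|u|^{l-1}u|\nabla u|^q+\gamma u^m+\mu|\nabla u|^r-\nu|u|^{\sigma-1}u\Big)\phi\,dx\,dt;$$ (iii) $u(\cdot,0)\le u_0$ (resp. $\ge u_0$) a.e. in $\Omega$, and $u\le 0$ (resp. $\ge 0$) on $\partial\Omega\times(0,T)$. Here $W_0^{1,\infty}(\Omega)=W^{1,\infty}(\Omega)\cap W_0^{1,1}(\Omega)$, and $u\in L^\infty(0,T;W_0^{1,\infty}(\Omega))$ means that $u,\nabla u\in L^\infty(Q_T)$ and $u(\cdot,t)\in W_0^{1,\infty}(\Omega)$ for a.e. $t\in(0,T)$. **Theorem (comparison principle).** Let $u,v\in L^\infty(0,T;W_0^{1,\infty}(\Omega))$ be, respectively,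 a weak sub-solution and a weak super-solution of (1) on $Q_T$ with the same initial datum $u_0$, and suppose that $u$ and $v$ are locally bounded. Then for every $t\in(0,T)$ we have $u(x,t)\le v(x,t)$ for a.e. $x\in\Omega$; in particular $u\le v$ a.e. in $Q_T$. -/

import Mathlib

open MeasureTheory Set Filter Topology
open scoped ContDiff

namespace PLap

/-- `ℝ^N` with its Euclidean norm. -/
abbrev Sp (N : ℕ) : Type := EuclideanSpace ℝ (Fin N)

variable {N : ℕ}

/-- The boundary of `Ω` is smooth: near each boundary point, `Ω` is the negativity set of a
`C^∞` function whose differential does not vanish at that point. -/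
def HasSmoothBoundary (Ω : Set (Sp N)) : Prop :=
  ∀ x₀ ∈ frontier Ω, ∃ U : Set (Sp N), IsOpen U ∧ x₀ ∈ U ∧
    ∃ g : Sp N → ℝ, ContDiffOn ℝ ∞ g U ∧ fderiv ℝ g x₀ ≠ 0 ∧ ∀ x ∈ U, (x ∈ Ω ↔ g x < 0)

/-- A bounded domain (nonempty, open, connected) with smooth boundary. -/
structure IsSmoothBoundedDomain (Ω : Set (Sp N)) : Prop where
  isOpen : IsOpen Ω
  isConnected : IsConnected Ω
  isBounded : Bornology.IsBounded Ω
  smooth : HasSmoothBoundary Ω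

/-- `ψ ∈ C_c^∞(W)` for an open subset `W` of a normed space. -/
def IsTestFunction {X : Type*} [NormedAddCommGroup X] [NormedSpace ℝ X]
    (W : Set X) (ψ : X → ℝ) : Prop :=
  ContDiff ℝ ∞ ψ ∧ HasCompactSupport ψ ∧ tsupport ψ ⊆ W

/-- `G` is the weak (distributional) gradient of `f` on `Ω`. -/
def HasWeakGradient (Ω : Set (Sp N)) (f : Sp N → ℝ) (G : Sp N → Sp N) : Prop :=
  LocallyIntegrableOn f Ω ∧ LocallyIntegrableOn G Ω ∧
    ∀ ψ : Sp N → ℝ, IsTestFunction Ω ψ →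
      ∫ x in Ω, f x • gradient ψ x = - ∫ x in Ω, ψ x • G x

/-- `f ∈ W^{1,a}(Ω)` with `∇f = G`, where `a ∈ [1,∞]`. -/
structure MemW1 (Ω : Set (Sp N)) (a : ENNReal) (f : Sp N → ℝ) (G : Sp N → Sp N) : Prop where
  memLp : MemLp f a (volume.restrict Ω)
  memLp_grad : MemLp G a (volume.restrict Ω)
  weakGrad : HasWeakGradient Ω f G

/-- `f` (with gradient `G`) is a limit of functions in `C_c^∞(Ω)` in the norm of `W^{1,a}(Ω)`. -/
def IsTestLimit (Ω : Set (Sp N)) (a : ENNReal) (f : Sp N → ℝ) (G : Sp N → Sp N) : Prop :=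
  ∃ ψ : ℕ → Sp N → ℝ, (∀ n, IsTestFunction Ω (ψ n)) ∧
    Tendsto (fun n => eLpNorm (fun x => f x - ψ n x) a (volume.restrict Ω)) atTop (𝓝 0) ∧
    Tendsto (fun n => eLpNorm (fun x => G x - gradient (ψ n) x) a (volume.restrict Ω))
      atTop (𝓝 0)

/-- `f ∈ W_0^{1,a}(Ω)` with `∇f = G`.  For `a < ∞` this is the closure of `C_c^∞(Ω)` in
`W^{1,a}(Ω)`.  For `a = ∞` the usual convention `W_0^{1,∞}(Ω) = W^{1,∞}(Ω) ∩ W_0^{1,1}(Ω)` is used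
(on a smooth bounded domain: the Lipschitz functions that vanish on the boundary). -/
structure MemW10 (Ω : Set (Sp N)) (a : ENNReal) (f : Sp N → ℝ) (G : Sp N → Sp N) : Prop where
  memW1 : MemW1 Ω a f G
  testLimit : IsTestLimit Ω (open Classical in if a = ⊤ then 1 else a) f G

/-- The cylinder `Q_T`; points are written `(t, x)`, time first. -/
def Cyl (Ω : Set (Sp N)) (T : ℝ) : Set (ℝ × Sp N) := Ioo 0 T ×ˢ Ω

/-- `u ∈ L^a(0,T; W_0^{1,a}(Ω))` with spatial gradient `∇u = Du`: both `u` and `Du` are in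
`L^a(Q_T)`, and for almost every `t` the slice `u(t,·)` is in `W_0^{1,a}(Ω)` with gradient
`Du(t,·)`. -/
structure MemLaW10 (Ω : Set (Sp N)) (T : ℝ) (a : ENNReal)
    (u : ℝ × Sp N → ℝ) (Du : ℝ × Sp N → Sp N) : Prop where
  memLp : MemLp u a (volume.restrict (Cyl Ω T))
  memLp_grad : MemLp Du a (volume.restrict (Cyl Ω T))
  slice : ∀ᵐ t ∂(volume.restrict (Ioo 0 T)), MemW10 Ω a (fun x => u (t, x)) (fun x => Du (t, x))

/-- `w` is the weak time derivative of `u` on `Q_T`. -/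
def HasWeakTimeDeriv (Ω : Set (Sp N)) (T : ℝ) (u w : ℝ × Sp N → ℝ) : Prop :=
  LocallyIntegrableOn u (Cyl Ω T) ∧ LocallyIntegrableOn w (Cyl Ω T) ∧
    ∀ ψ : ℝ × Sp N → ℝ, IsTestFunction (Cyl Ω T) ψ →
      ∫ z in Cyl Ω T, u z * fderiv ℝ ψ z (1, 0) = - ∫ z in Cyl Ω T, w z * ψ z

/-- The coefficients and exponents of the equation. -/
structure Params where
  α : ℝ
  β : ℝ
  γ : ℝ
  μ : ℝ
  ν : ℝ
  p : ℝ
  q : ℝ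
  r : ℝ
  k : ℝ
  l : ℝ
  m : ℝ
  s : ℝ
  σ : ℝ

/-- The integrability exponent `max {p, k+s, l+q, m, r, σ}`. -/
noncomputable def Params.topExp (P : Params) : ℝ :=
  max P.p (max (P.k + P.s) (max (P.l + P.q) (max P.m (max P.r P.σ))))

/-- The right-hand side
`α|u|^{k-1}u ∫_Ω |u|^s dy - β|u|^{l-1}u|∇u|^q + γu^m + μ|∇u|^r - ν|u|^{σ-1}u` at `z = (t, x)`. -/
noncomputable def rhs (P : Params) (Ω : Set (Sp N)) (u : ℝ × Sp N → ℝ) (Du : ℝ × Sp N → Sp N)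
    (z : ℝ × Sp N) : ℝ :=
  P.α * (|u z| ^ (P.k - 1) * u z) * (∫ y in Ω, |u (z.1, y)| ^ P.s)
    - P.β * (|u z| ^ (P.l - 1) * u z) * ‖Du z‖ ^ P.q
    + P.γ * u z ^ P.m
    + P.μ * ‖Du z‖ ^ P.r
    - P.ν * (|u z| ^ (P.σ - 1) * u z)

/-- `φ`, with spatial gradient `Dφ`, is an admissible nonnegative test function:
`φ ∈ C(closure Q_T) ∩ L^p(0,T; W_0^{1,p}(Ω))`. -/
structure IsAdmissible (p : ℝ) (Ω : Set (Sp N)) (T : ℝ)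
    (φ : ℝ × Sp N → ℝ) (Dφ : ℝ × Sp N → Sp N) : Prop where
  nonneg : ∀ z ∈ Icc 0 T ×ˢ closure Ω, 0 ≤ φ z
  continuousOn : ContinuousOn φ (Icc 0 T ×ˢ closure Ω)
  memLaW10 : MemLaW10 Ω T (ENNReal.ofReal p) φ Dφ

/-- The notion of weak solution, sub-solution or super-solution on `Q_T` with initial datum `u₀`,
according to whether the relation `R` is `=`, `≤` or `≥`.  The spatial gradient `Du` and the
time derivative `ut` are unique up to null sets. -/
structure IsWeak (R : ℝ → ℝ → Prop) (P : Params) (Ω : Set (Sp N)) (T : ℝ) (u₀ : Sp N → ℝ)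
    (u : ℝ × Sp N → ℝ) : Prop where
  nonneg : ∀ z ∈ Ico 0 T ×ˢ closure Ω, 0 ≤ u z
  continuousOn : ContinuousOn u (Ico 0 T ×ˢ closure Ω)
  weak : ∃ (Du : ℝ × Sp N → Sp N) (ut : ℝ × Sp N → ℝ),
    MemLaW10 Ω T (ENNReal.ofReal P.topExp) u Du ∧
    HasWeakTimeDeriv Ω T u ut ∧ MemLp ut 2 (volume.restrict (Cyl Ω T)) ∧
    ∀ (φ : ℝ × Sp N → ℝ) (Dφ : ℝ × Sp N → Sp N), IsAdmissible P.p Ω T φ Dφ →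
      R (∫ z in Cyl Ω T, (ut z * φ z + ‖Du z‖ ^ (P.p - 2) * inner ℝ (Du z) (Dφ z)))
        (∫ z in Cyl Ω T, rhs P Ω u Du z * φ z)
  initial : ∀ᵐ x ∂(volume.restrict Ω), R (u (0, x)) (u₀ x)
  boundary : ∀ t ∈ Ioo 0 T, ∀ x ∈ frontier Ω, R (u (t, x)) 0

/-- Weak sub-solution. -/
def IsWeakSub (P : Params) (Ω : Set (Sp N)) (T : ℝ) (u₀ : Sp N → ℝ) (u : ℝ × Sp N → ℝ) : Prop :=
  IsWeak (fun a b => a ≤ b) P Ω T u₀ u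

/-- Weak super-solution. -/
def IsWeakSuper (P : Params) (Ω : Set (Sp N)) (T : ℝ) (u₀ : Sp N → ℝ) (u : ℝ × Sp N → ℝ) : Prop :=
  IsWeak (fun a b => a ≥ b) P Ω T u₀ u

/-- Admissible initial data: `u₀ ≥ 0`, `u₀ ≢ 0`, `u₀ ∈ W^{1,∞}(Ω)`. -/
structure IsInitialDatum (Ω : Set (Sp N)) (u₀ : Sp N → ℝ) : Prop where
  nonneg : ∀ᵐ x ∂(volume.restrict Ω), 0 ≤ u₀ x
  ne_zero : ¬ ∀ᵐ x ∂(volume.restrict Ω), u₀ x = 0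
  memW1 : ∃ G : Sp N → Sp N, MemW1 Ω ⊤ u₀ G

/-- `u` is locally bounded on `Q_T`. -/
def IsLocallyBounded (Ω : Set (Sp N)) (T : ℝ) (u : ℝ × Sp N → ℝ) : Prop :=
  ∀ z ∈ Cyl Ω T, ∃ V ∈ 𝓝 z, ∃ C : ℝ, ∀ y ∈ V ∩ Cyl Ω T, |u y| ≤ C

end PLap

/-!
The comparison principle is an energy estimate for the positive part of `w = u - v`. The test
function is `χ(t) (w⁺)²` with a cutoff `χ` in time: its gradient is `2 χ w⁺ ∇w`, so it depends on
`w` in a `C¹` way with Lipschitz derivative, which keeps the chain rule in `W_0^{1,p}` elementary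
(`IsTestLimit.comp`), and it has the same homogeneity as the energy `Y(t) = ∫ (w⁺)³`.

After subtraction of the two weak formulations there are three kinds of terms.

* The time derivative gives `Y(τ) / 3`. A function with a weak time derivative is, on almost every
  vertical line, the primitive of that derivative (`HasWeakTimeDeriv.ae_eq_add_integral`), and the
  chain rule for absolutely continuous functions applies there
  (`IsBoundedCandidate.integral_timeDeriv_mul`). The initial condition makes `Y(0) = 0`.
* The diffusion gives `2 w⁺` times a quantity that controls `X²`, where
  `X = | |∇u|^{p/2} - |∇v|^{p/2} |` (`flux_monotone`, which needs `p ≥ 2`).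
* The right-hand side is one-sidedly Lipschitz where `u > v`: since `q, r ≥ p/2` and all quantities
  are bounded, the difference is at most `C (w + ∫ w⁺ + X)`
  (`Params.exists_reaction_sub_le`). The absorption terms with exponents `l` and `σ` may fail to
  be Lipschitz at `0`, but they are monotone with the good sign.

By Young's inequality the contribution of `X` is absorbed by the diffusion (`absorb_gradient`), the
nonlocal term is of the order of `Y` as well, and `Y(τ) ≤ C ∫₀^τ Y` follows. Gronwall's inequality
(`eq_zero_of_le_integral`) gives `Y = 0`.

Bounds on `u` hold everywhere because `u` is continuous and essentially bounded; bounds on the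
gradients hold almost everywhere because weak gradients are unique.
-/

namespace PLap

/-! ### Elementary inequalities for real powers -/

/-- Tangent-line inequality for the convex function `x ^ e`, a form of Bernoulli's inequality. -/
lemma rpow_sub_rpow_le {e x y : ℝ} (he : 1 ≤ e) (hy : 0 ≤ y) (hxy : y ≤ x) :
    x ^ e - y ^ e ≤ e * x ^ (e - 1) * (x - y) := by
  rcases (hy.trans hxy).eq_or_lt with hx | hx
  · have : y = 0 := by linarith
    subst this; subst hx; simp
  have hb := one_add_mul_self_le_rpow_one_add (s := y / x - 1)
    (by have : 0 ≤ y / x := by positivity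
        linarith) he
  have h1 : (1 + (y / x - 1)) ^ e = y ^ e / x ^ e := by
    rw [← Real.div_rpow hy hx.le]; congr 1; ring
  rw [h1, le_div_iff₀ (by positivity)] at hb
  have h2 : x ^ e = x ^ (e - 1) * x := by
    rw [← Real.rpow_add_one hx.ne']; congr 1; ring
  have h3 : (1 + e * (y / x - 1)) * x ^ e = x ^ e - e * x ^ (e - 1) * (x - y) := by
    rw [h2]; field_simp; ring
  linarith

/-- `x ↦ x ^ e` is Lipschitz on `[0, K]` for `e ≥ 1`. -/
lemma abs_rpow_sub_rpow_le {e x y K : ℝ} (he : 1 ≤ e) (hx : 0 ≤ x) (hy : 0 ≤ y)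
    (hxK : x ≤ K) (hyK : y ≤ K) : |x ^ e - y ^ e| ≤ e * K ^ (e - 1) * |x - y| := by
  wlog hxy : y ≤ x generalizing x y
  · rw [abs_sub_comm, abs_sub_comm x y]
    exact this hy hx hyK hxK (le_of_not_ge hxy)
  have h1 := Real.rpow_le_rpow hy hxy (by linarith : 0 ≤ e)
  rw [abs_of_nonneg (by linarith), abs_of_nonneg (by linarith)]
  refine (rpow_sub_rpow_le he hy hxy).trans ?_
  have h2 := Real.rpow_le_rpow hx hxK (by linarith : 0 ≤ e - 1)
  have : 0 ≤ x - y := by linarith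
  gcongr

/-- On a bounded range, a difference of `q`-th powers is controlled by the difference of the
`p/2`-th powers as soon as `q ≥ p/2`. -/
lemma exists_abs_rpow_sub_rpow_le {p q K : ℝ} (hp : 0 < p) (hq : p / 2 ≤ q) (hK : 0 ≤ K) :
    ∃ C, 0 ≤ C ∧ ∀ x y : ℝ, 0 ≤ x → 0 ≤ y → x ≤ K → y ≤ K →
      |x ^ q - y ^ q| ≤ C * |x ^ (p / 2) - y ^ (p / 2)| := by
  have he : 1 ≤ 2 * q / p := by rw [le_div_iff₀ hp]; linarith
  refine ⟨2 * q / p * (K ^ (p / 2)) ^ (2 * q / p - 1), by positivity, fun x y hx hy hxK hyK => ?_⟩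
  have hpow : ∀ z : ℝ, 0 ≤ z → z ^ q = (z ^ (p / 2)) ^ (2 * q / p) := fun z hz => by
    rw [← Real.rpow_mul hz]; congr 1; field_simp
  rw [hpow x hx, hpow y hy]
  exact abs_rpow_sub_rpow_le he (by positivity) (by positivity)
    (Real.rpow_le_rpow hx hxK (by linarith)) (Real.rpow_le_rpow hy hyK (by linarith))

lemma sq_rpow_half_sub_le {p x y : ℝ} (hp : 2 ≤ p) (hx : 0 ≤ x) (hy : 0 ≤ y) :
    (x ^ (p / 2) - y ^ (p / 2)) ^ 2 ≤ p / 2 * ((x ^ (p - 1) - y ^ (p - 1)) * (x - y)) := by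
  wlog hxy : y ≤ x generalizing x y
  · have := this hy hx (le_of_not_ge hxy)
    nlinarith
  have h1 := rpow_sub_rpow_le (e := p / 2) (by linarith) hy hxy
  have h2 := Real.rpow_le_rpow hy hxy (by linarith : 0 ≤ p / 2)
  have h3 := Real.rpow_le_rpow hy hxy (by linarith : 0 ≤ p / 2 - 1)
  have h4 : ∀ z : ℝ, 0 ≤ z → z ^ (p - 1) = z ^ (p / 2 - 1) * z ^ (p / 2) := fun z hz => by
    rw [← Real.rpow_add_of_nonneg hz (by linarith) (by linarith)]; congr 1; ring
  have h5 : x ^ (p / 2 - 1) * (x ^ (p / 2) - y ^ (p / 2)) ≤ x ^ (p - 1) - y ^ (p - 1) := by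
    rw [h4 x hx, h4 y hy]
    have : 0 ≤ y ^ (p / 2) := by positivity
    nlinarith
  calc (x ^ (p / 2) - y ^ (p / 2)) ^ 2
      ≤ (x ^ (p / 2) - y ^ (p / 2)) * (p / 2 * x ^ (p / 2 - 1) * (x - y)) := by
        rw [sq]; exact mul_le_mul_of_nonneg_left h1 (by linarith)
    _ = p / 2 * (x ^ (p / 2 - 1) * (x ^ (p / 2) - y ^ (p / 2)) * (x - y)) := by ring
    _ ≤ _ := by
        have : 0 ≤ x - y := by linarith
        gcongr

/-- Quantitative monotonicity of the `p`-Laplace flux for `p ≥ 2`: it controls the square of the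
difference of the `p/2`-th powers of the norms. -/
lemma flux_monotone {E : Type*} [NormedAddCommGroup E] [InnerProductSpace ℝ E] {p : ℝ}
    (hp : 2 ≤ p) (a b : E) :
    (‖a‖ ^ (p / 2) - ‖b‖ ^ (p / 2)) ^ 2 ≤
      p / 2 * (‖a‖ ^ (p - 2) * inner ℝ a (a - b) - ‖b‖ ^ (p - 2) * inner ℝ b (a - b)) := by
  refine (sq_rpow_half_sub_le hp (norm_nonneg a) (norm_nonneg b)).trans ?_
  have h4 : ∀ z : ℝ, 0 ≤ z → z ^ (p - 1) = z ^ (p - 2) * z := fun z hz => by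
    conv_rhs => rw [← Real.rpow_one z]
    rw [← Real.rpow_mul hz, one_mul, ← Real.rpow_add_of_nonneg hz (by linarith) (by linarith)]
    congr 1; ring
  rw [h4 _ (norm_nonneg a), h4 _ (norm_nonneg b), inner_sub_right, inner_sub_right,
    real_inner_self_eq_norm_sq, real_inner_self_eq_norm_sq, real_inner_comm a b]
  have hab := real_inner_le_norm a b
  have ha : 0 ≤ ‖a‖ ^ (p - 2) := by positivity
  have hb : 0 ≤ ‖b‖ ^ (p - 2) := by positivity
  have : 0 ≤ (‖a‖ ^ (p - 2) + ‖b‖ ^ (p - 2)) * (‖a‖ * ‖b‖ - inner ℝ a b) :=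
    mul_nonneg (by linarith) (by linarith)
  refine mul_le_mul_of_nonneg_left ?_ (by linarith)
  linarith

lemma abs_rpow_mul_self_eq {e x : ℝ} (he : 0 < e) (hx : 0 ≤ x) : |x| ^ (e - 1) * x = x ^ e := by
  rw [abs_of_nonneg hx]
  rcases hx.eq_or_lt with rfl | hx
  · simp [he.ne']
  · rw [← Real.rpow_add_one hx.ne']; congr 1; ring

/-- The right-hand side of the equation as a function of the value `x` of the solution, the norm
`a` of its gradient and the value `J` of the nonlocal integral. -/
noncomputable def Params.reaction (P : Params) (x a J : ℝ) : ℝ :=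
  P.α * (|x| ^ (P.k - 1) * x) * J - P.β * (|x| ^ (P.l - 1) * x) * a ^ P.q
    + P.γ * x ^ P.m + P.μ * a ^ P.r - P.ν * (|x| ^ (P.σ - 1) * x)

/-- One-sided Lipschitz estimate for the reaction term. The absorption terms are monotone with a
favourable sign, so that the exponents `l` and `σ` may be smaller than `1`. -/
lemma Params.exists_reaction_sub_le (P : Params)
    (hα : 0 < P.α) (hl : 0 < P.l) (hσ : 0 < P.σ) (hβ : 0 ≤ P.β) (hν : 0 ≤ P.ν)
    (hr : P.p - 1 ≤ P.r) (hp : P.p / 2 ≤ P.p - 1) (hq : P.p / 2 ≤ P.q)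
    (hk : 1 ≤ P.k) (hm : 1 ≤ P.m) {M K B : ℝ} (hM : 0 ≤ M) (hK : 0 ≤ K) (hB : 0 ≤ B) :
    ∃ C, 0 ≤ C ∧ ∀ x y a b J J' I : ℝ, 0 ≤ y → y ≤ x → x ≤ M → 0 ≤ a → a ≤ K → 0 ≤ b → b ≤ K →
      0 ≤ J → J ≤ B → J - J' ≤ B * I → 0 ≤ I →
      P.reaction x a J - P.reaction y b J' ≤
        C * (x - y) + C * I + C * |a ^ (P.p / 2) - b ^ (P.p / 2)| := by
  obtain ⟨Cq, hCq, hq'⟩ := exists_abs_rpow_sub_rpow_le (p := P.p) (by linarith) hq hK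
  obtain ⟨Cr, hCr, hr'⟩ := exists_abs_rpow_sub_rpow_le (p := P.p) (q := P.r)
    (by linarith) (by linarith) hK
  set C1 := P.α * (P.k * M ^ (P.k - 1)) * B + |P.γ| * (P.m * M ^ (P.m - 1)) with hC1
  set C2 := P.α * M ^ P.k * B with hC2
  set C3 := P.β * M ^ P.l * Cq + |P.μ| * Cr with hC3
  have h1 : 0 ≤ C1 := by positivity
  have h2 : 0 ≤ C2 := by positivity
  have h3 : 0 ≤ C3 := by positivity
  refine ⟨C1 + C2 + C3, by positivity, ?_⟩
  intro x y a b J J' I hy hyx hxM ha haK hb hbK hJ hJB hJJ hI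
  have hx : 0 ≤ x := hy.trans hyx
  have hyM : y ≤ M := hyx.trans hxM
  set X := |a ^ (P.p / 2) - b ^ (P.p / 2)| with hX
  have hX0 : 0 ≤ X := abs_nonneg _
  unfold Params.reaction
  simp only [abs_rpow_mul_self_eq (show 0 < P.k by linarith) hx,
    abs_rpow_mul_self_eq (show 0 < P.k by linarith) hy, abs_rpow_mul_self_eq hl hx,
    abs_rpow_mul_self_eq hl hy, abs_rpow_mul_self_eq hσ hx, abs_rpow_mul_self_eq hσ hy]
  -- the nonlocal source
  have e1 : P.α * x ^ P.k * J - P.α * y ^ P.k * J' ≤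
      P.α * (P.k * M ^ (P.k - 1)) * B * (x - y) + C2 * I := by
    have i1 : x ^ P.k - y ^ P.k ≤ P.k * M ^ (P.k - 1) * (x - y) := by
      have := abs_rpow_sub_rpow_le hk hx hy hxM hyM
      rw [abs_of_nonneg (sub_nonneg.2 hyx)] at this
      exact (le_abs_self _).trans this
    have i2 : (x ^ P.k - y ^ P.k) * J ≤ P.k * M ^ (P.k - 1) * (x - y) * B := by
      refine (mul_le_mul_of_nonneg_right i1 hJ).trans (mul_le_mul_of_nonneg_left hJB ?_)
      have : 0 ≤ x - y := by linarith
      positivity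
    have i3 : y ^ P.k * (J - J') ≤ M ^ P.k * (B * I) := by
      refine (mul_le_mul_of_nonneg_left hJJ (by positivity)).trans ?_
      have := Real.rpow_le_rpow hy hyM (show 0 ≤ P.k by linarith)
      gcongr
    have := mul_le_mul_of_nonneg_left (add_le_add i2 i3) hα.le
    rw [hC2]; linarith
  -- the gradient absorption
  have e2 : -(P.β * x ^ P.l * a ^ P.q) + P.β * y ^ P.l * b ^ P.q ≤ P.β * M ^ P.l * Cq * X := by
    have i1 := (abs_le.1 (hq' a b ha hb haK hbK)).1
    have i2 := Real.rpow_le_rpow hy hyx hl.le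
    have i3 := Real.rpow_le_rpow hy hyM hl.le
    have i4 : y ^ P.l * (b ^ P.q - a ^ P.q) ≤ M ^ P.l * (Cq * X) := by
      refine (mul_le_mul_of_nonneg_left (by linarith : _ ≤ Cq * X) (by positivity)).trans ?_
      gcongr
    have i5 : y ^ P.l * a ^ P.q ≤ x ^ P.l * a ^ P.q := by gcongr
    have := mul_le_mul_of_nonneg_left (add_le_add i4 i5) hβ
    linarith
  have e3 : P.γ * x ^ P.m - P.γ * y ^ P.m ≤ |P.γ| * (P.m * M ^ (P.m - 1)) * (x - y) := by
    have i1 := abs_rpow_sub_rpow_le hm hx hy hxM hyM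
    rw [abs_of_nonneg (sub_nonneg.2 hyx)] at i1
    calc P.γ * x ^ P.m - P.γ * y ^ P.m ≤ |P.γ * (x ^ P.m - y ^ P.m)| := by
          rw [← mul_sub]; exact le_abs_self _
      _ ≤ |P.γ| * (P.m * M ^ (P.m - 1) * (x - y)) := by rw [abs_mul]; gcongr
      _ = _ := by ring
  have e4 : P.μ * a ^ P.r - P.μ * b ^ P.r ≤ |P.μ| * Cr * X := by
    calc P.μ * a ^ P.r - P.μ * b ^ P.r ≤ |P.μ * (a ^ P.r - b ^ P.r)| := by
          rw [← mul_sub]; exact le_abs_self _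
      _ ≤ |P.μ| * (Cr * X) := by rw [abs_mul]; gcongr; exact hr' a b ha hb haK hbK
      _ = _ := by ring
  have e5 : P.ν * y ^ P.σ ≤ P.ν * x ^ P.σ := by
    have := Real.rpow_le_rpow hy hyx hσ.le
    gcongr
  have f1 : 0 ≤ (C2 + C3) * (x - y) := mul_nonneg (by positivity) (by linarith)
  have f2 : 0 ≤ (C1 + C3) * I := by positivity
  have f3 : 0 ≤ (C1 + C2) * X := by positivity
  have f4 : C1 * (x - y) = P.α * (P.k * M ^ (P.k - 1)) * B * (x - y) +
    |P.γ| * (P.m * M ^ (P.m - 1)) * (x - y) := by rw [hC1]; ring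
  have f5 : C3 * X = P.β * M ^ P.l * Cq * X + |P.μ| * Cr * X := by rw [hC3]; ring
  linarith

/-- Young's inequality in the form that absorbs the gradient terms: `p > 0` and the weights `w²`
and `2w` are those of the test function `w²` and of its gradient. -/
lemma absorb_gradient {p C w X F : ℝ} (hp : 0 < p) (hw : 0 ≤ w)
    (hF : X ^ 2 ≤ p / 2 * F) : C * X * w ^ 2 ≤ 2 * w * F + C ^ 2 * p / 16 * w ^ 3 := by
  have h1 : 4 / p * X ^ 2 ≤ 2 * F := by
    rw [div_mul_eq_mul_div, div_le_iff₀ hp]; linarith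
  have h2 : C * X * w ≤ 4 / p * X ^ 2 + C ^ 2 * p / 16 * w ^ 2 := by
    have : 4 / p * X ^ 2 + C ^ 2 * p / 16 * w ^ 2 - C * X * w =
        4 / p * (X - C * p / 8 * w) ^ 2 := by
      field_simp; ring
    have h3 : 0 ≤ 4 / p * (X - C * p / 8 * w) ^ 2 := by positivity
    linarith
  have := mul_le_mul_of_nonneg_left (h2.trans (add_le_add_left h1 _)) hw
  nlinarith

variable {N : ℕ}

/-! ### Sobolev functions with zero boundary values -/

/-- A sequence dominated by null sequences of `L^a` functions and by a null sequence of multiples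
of a fixed `L^a` function is a null sequence in `L^a`. -/
lemma tendsto_eLpNorm_zero_of_le {X E₁ E₂ E₃ E₄ : Type*} [MeasurableSpace X]
    [NormedAddCommGroup E₁] [NormedAddCommGroup E₂] [NormedAddCommGroup E₃]
    [NormedAddCommGroup E₄] {m : Measure X} {a : ENNReal} (ha : 1 ≤ a) {F : ℕ → X → E₁}
    {A : ℕ → X → E₂} {B : ℕ → X → E₃} {D : X → E₄} {C : ℝ} {c : ℕ → ℝ}
    (hAm : ∀ n, AEStronglyMeasurable (A n) m) (hBm : ∀ n, AEStronglyMeasurable (B n) m)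
    (hA : Tendsto (fun n => eLpNorm (A n) a m) atTop (𝓝 0))
    (hB : Tendsto (fun n => eLpNorm (B n) a m) atTop (𝓝 0))
    (hD : MemLp D a m) (hc : Tendsto c atTop (𝓝 0))
    (hF : ∀ n, ∀ᵐ x ∂m, ‖F n x‖ ≤ C * ‖A n x‖ + C * ‖B n x‖ + c n * ‖D x‖) :
    Tendsto (fun n => eLpNorm (F n) a m) atTop (𝓝 0) := by
  have hle : ∀ n, eLpNorm (F n) a m ≤
      ‖C‖ₑ * eLpNorm (A n) a m + ‖C‖ₑ * eLpNorm (B n) a m + ‖c n‖ₑ * eLpNorm D a m := by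
    intro n
    have h1 : eLpNorm (F n) a m ≤ eLpNorm (((C • fun x => ‖A n x‖) + (C • fun x => ‖B n x‖)) +
        (c n • fun x => ‖D x‖)) a m :=
      eLpNorm_mono_ae_real (hF n)
    refine h1.trans ((eLpNorm_add_le (((hAm n).norm.const_smul C).add ((hBm n).norm.const_smul C))
      (hD.1.norm.const_smul _) ha).trans ?_)
    refine add_le_add ((eLpNorm_add_le ((hAm n).norm.const_smul C) ((hBm n).norm.const_smul C)
      ha).trans ?_) ?_
    · rw [eLpNorm_const_smul, eLpNorm_const_smul, eLpNorm_norm, eLpNorm_norm]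
    · rw [eLpNorm_const_smul, eLpNorm_norm]
  refine tendsto_of_tendsto_of_tendsto_of_le_of_le tendsto_const_nhds ?_ (fun n => zero_le) hle
  have hc' : Tendsto (fun n => ‖c n‖ₑ) atTop (𝓝 0) := by simpa using hc.enorm
  have h2 := ENNReal.Tendsto.mul_const (b := eLpNorm D a m) hc' (Or.inr hD.2.ne)
  have h3 := ENNReal.Tendsto.const_mul (a := ‖C‖ₑ) hA (Or.inr enorm_ne_top)
  have h4 := ENNReal.Tendsto.const_mul (a := ‖C‖ₑ) hB (Or.inr enorm_ne_top)
  simpa using (h3.add h4).add h2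

lemma IsTestFunction.continuous_gradient {Ω : Set (Sp N)} {ψ : Sp N → ℝ}
    (h : IsTestFunction Ω ψ) : Continuous (gradient ψ) :=
  (InnerProductSpace.toDual ℝ (Sp N)).symm.continuous.comp
    (h.1.continuous_fderiv (by simp))

lemma IsTestFunction.hasCompactSupport_gradient {Ω : Set (Sp N)} {ψ : Sp N → ℝ}
    (h : IsTestFunction Ω ψ) : HasCompactSupport (gradient ψ) :=
  (h.2.1.fderiv ℝ).comp_left (g := (InnerProductSpace.toDual ℝ (Sp N)).symm) (map_zero _)

/-- Integration by parts for two test functions. -/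
lemma IsTestFunction.integral_smul_gradient {Ω : Set (Sp N)} {ψ η : Sp N → ℝ}
    (hψ : IsTestFunction Ω ψ) (hη : IsTestFunction Ω η) :
    ∫ x in Ω, ψ x • gradient η x = - ∫ x in Ω, η x • gradient ψ x := by
  have hz : ∀ {f : Sp N → ℝ} {G : Sp N → Sp N}, IsTestFunction Ω f →
      ∀ x ∉ Ω, f x • G x = 0 := fun hf x hx => by
    rw [image_eq_zero_of_notMem_tsupport (fun h => hx (hf.2.2 h)), zero_smul]
  rw [setIntegral_eq_integral_of_forall_compl_eq_zero (hz hψ),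
    setIntegral_eq_integral_of_forall_compl_eq_zero (hz hη)]
  have hint : ∀ {f g : Sp N → ℝ}, IsTestFunction Ω f → IsTestFunction Ω g →
      Integrable (fun x => f x • gradient g x) := fun hf hg =>
    (hf.1.continuous.smul hg.continuous_gradient).integrable_of_hasCompactSupport
      hf.2.1.smul_right
  refine ext_inner_left ℝ fun w => ?_
  rw [inner_neg_right, ← integral_inner (hint hψ hη), ← integral_inner (hint hη hψ)]
  simp only [real_inner_smul_right, inner_gradient_right, conj_trivial]
  have hdη : Continuous fun x => fderiv ℝ η x w :=
    (hη.1.continuous_fderiv (by simp)).clm_apply continuous_const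
  have hdψ : Continuous fun x => fderiv ℝ ψ x w :=
    (hψ.1.continuous_fderiv (by simp)).clm_apply continuous_const
  rw [integral_mul_fderiv_eq_neg_fderiv_mul_of_integrable]
  · simp only [mul_comm]
  · exact (hdψ.mul hη.1.continuous).integrable_of_hasCompactSupport hη.2.1.mul_left
  · exact (hψ.1.continuous.mul hdη).integrable_of_hasCompactSupport hψ.2.1.mul_right
  · exact (hψ.1.continuous.mul hη.1.continuous).integrable_of_hasCompactSupport hψ.2.1.mul_right
  · exact fun x _ => (hψ.1.differentiable (by simp)) x
  · exact fun x _ => (hη.1.differentiable (by simp)) x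

lemma tendsto_integral_smul {X E : Type*} [MeasurableSpace X] {m : Measure X}
    [NormedAddCommGroup E] [NormedSpace ℝ E]
    {F : ℕ → X → ℝ} {f : X → ℝ} {G : ℕ → X → E} {g : X → E}
    (hF : ∀ n, Integrable (fun x => F n x • G n x) m)
    (hf : Integrable (fun x => f x • g x) m)
    (hlim : Tendsto (fun n => eLpNorm (fun x => f x • g x - F n x • G n x) 1 m) atTop (𝓝 0)) :
    Tendsto (fun n => ∫ x, F n x • G n x ∂m) atTop (𝓝 (∫ x, f x • g x ∂m)) := by
  refine tendsto_integral_of_L1' _ hf.1 (Eventually.of_forall hF) ?_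
  refine hlim.congr fun n => ?_
  rw [← eLpNorm_neg]; congr 1; ext x; simp

/-- Convergence in a larger `L^b` implies convergence in `L^a`. -/
lemma IsTestLimit.mono_exponent {Ω : Set (Sp N)} [IsFiniteMeasure (volume.restrict Ω)]
    {a b : ENNReal} (hab : a ≤ b) (ha : 1 ≤ a) {f : Sp N → ℝ}
    {G : Sp N → Sp N} (hf : AEStronglyMeasurable f (volume.restrict Ω))
    (hG : AEStronglyMeasurable G (volume.restrict Ω)) (h : IsTestLimit Ω b f G) :
    IsTestLimit Ω a f G := by
  obtain ⟨ψ, hψ, h1, h2⟩ := h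
  have hfin : (volume.restrict Ω) univ ^ (1 / a.toReal - 1 / b.toReal) ≠ ⊤ := by
    refine ENNReal.rpow_ne_top_of_nonneg ?_ (measure_ne_top _ _)
    rcases eq_or_ne b ⊤ with rfl | hb
    · simp
    · have h0 : 0 < a.toReal :=
        ENNReal.toReal_pos (zero_lt_one.trans_le ha).ne' (ne_top_of_le_ne_top hb hab)
      exact sub_nonneg.2 (one_div_le_one_div_of_le h0 (ENNReal.toReal_mono hb hab))
  refine ⟨ψ, hψ, ?_, ?_⟩
  · refine tendsto_of_tendsto_of_tendsto_of_le_of_le tendsto_const_nhds ?_ (fun n => zero_le)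
      (fun n => eLpNorm_le_eLpNorm_mul_rpow_measure_univ hab
        (hf.sub (hψ n).1.continuous.aestronglyMeasurable))
    simpa using ENNReal.Tendsto.mul_const h1 (Or.inr hfin)
  · refine tendsto_of_tendsto_of_tendsto_of_le_of_le tendsto_const_nhds ?_ (fun n => zero_le)
      (fun n => eLpNorm_le_eLpNorm_mul_rpow_measure_univ hab
        (hG.sub (hψ n).continuous_gradient.aestronglyMeasurable))
    simpa using ENNReal.Tendsto.mul_const h2 (Or.inr hfin)

/-- A limit of test functions has its limit gradient as weak gradient. -/
lemma IsTestLimit.hasWeakGradient {Ω : Set (Sp N)} [IsFiniteMeasure (volume.restrict Ω)]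
    {a : ENNReal} (ha : 1 ≤ a) {f : Sp N → ℝ} {G : Sp N → Sp N}
    (hf : MemLp f a (volume.restrict Ω)) (hG : MemLp G a (volume.restrict Ω))
    (h : IsTestLimit Ω a f G) : HasWeakGradient Ω f G := by
  obtain ⟨ψ, hψ, h1, h2⟩ := h.mono_exponent ha le_rfl hf.1 hG.1
  have hfi : IntegrableOn f Ω := hf.integrable ha
  have hGi : IntegrableOn G Ω := hG.integrable ha
  refine ⟨hfi.locallyIntegrableOn, hGi.locallyIntegrableOn, fun η hη => ?_⟩
  obtain ⟨C, hC⟩ := hη.1.continuous.bounded_above_of_compact_support hη.2.1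
  obtain ⟨C', hC'⟩ :=
    hη.continuous_gradient.bounded_above_of_compact_support hη.hasCompactSupport_gradient
  have hηm : AEStronglyMeasurable η (volume.restrict Ω) := hη.1.continuous.aestronglyMeasurable
  have hηm' : AEStronglyMeasurable (gradient η) (volume.restrict Ω) :=
    hη.continuous_gradient.aestronglyMeasurable
  have hψm : ∀ n, AEStronglyMeasurable (fun x => f x - ψ n x) (volume.restrict Ω) := fun n =>
    hf.1.sub (hψ n).1.continuous.aestronglyMeasurable
  have hψm' : ∀ n, AEStronglyMeasurable (fun x => G x - gradient (ψ n) x) (volume.restrict Ω) :=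
    fun n => hG.1.sub (hψ n).continuous_gradient.aestronglyMeasurable
  have hint : ∀ {f g : Sp N → ℝ}, IsTestFunction Ω f → IsTestFunction Ω g →
      Integrable (fun x => f x • gradient g x) (volume.restrict Ω) := fun hf hg =>
    ((hf.1.continuous.smul hg.continuous_gradient).integrable_of_hasCompactSupport
      hf.2.1.smul_right).integrableOn
  have l1 : Tendsto (fun n => ∫ x in Ω, ψ n x • gradient η x) atTop
      (𝓝 (∫ x in Ω, f x • gradient η x)) := by
    refine tendsto_integral_smul (fun n => hint (hψ n) hη)
      (hfi.smul_bdd _ hηm' (Eventually.of_forall hC')) ?_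
    refine tendsto_eLpNorm_zero_of_le (C := C') (c := 0) (D := f) le_rfl hψm hψm h1 h1
      (memLp_one_iff_integrable.2 hfi) tendsto_const_nhds fun n => Eventually.of_forall fun x => ?_
    rw [← sub_smul, norm_smul]
    have := mul_le_mul_of_nonneg_left (hC' x) (norm_nonneg (f x - ψ n x))
    have h0 := mul_nonneg ((norm_nonneg _).trans (hC' x)) (norm_nonneg (f x - ψ n x))
    simp only [Pi.zero_apply, zero_mul]
    linarith
  have l2 : Tendsto (fun n => ∫ x in Ω, η x • gradient (ψ n) x) atTop
      (𝓝 (∫ x in Ω, η x • G x)) := by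
    refine tendsto_integral_smul (fun n => hint hη (hψ n))
      (hGi.bdd_smul _ hηm (Eventually.of_forall hC)) ?_
    refine tendsto_eLpNorm_zero_of_le (C := C) (c := 0) (D := f) le_rfl hψm' hψm' h2 h2
      (memLp_one_iff_integrable.2 hfi) tendsto_const_nhds fun n => Eventually.of_forall fun x => ?_
    rw [← smul_sub, norm_smul]
    have := mul_le_mul_of_nonneg_right (hC x) (norm_nonneg (G x - gradient (ψ n) x))
    have h0 := mul_nonneg ((norm_nonneg _).trans (hC x)) (norm_nonneg (G x - gradient (ψ n) x))
    simp only [Pi.zero_apply, zero_mul]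
    linarith
  refine tendsto_nhds_unique l1 (l2.neg.congr fun n => ?_)
  exact ((hψ n).integral_smul_gradient hη).symm

/-- Weak gradients are unique up to null sets. -/
lemma HasWeakGradient.ae_eq {Ω : Set (Sp N)} (hΩ : IsOpen Ω) {f : Sp N → ℝ} {G G' : Sp N → Sp N}
    (h : HasWeakGradient Ω f G) (h' : HasWeakGradient Ω f G')
    (hi : IntegrableOn G Ω) (hi' : IntegrableOn G' Ω) :
    ∀ᵐ x ∂(volume.restrict Ω), G x = G' x := by
  rw [ae_restrict_iff' hΩ.measurableSet]
  have := hΩ.ae_eq_zero_of_integral_contDiff_smul_eq_zero (f := fun x => G x - G' x)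
    (μ := volume) (h.2.1.sub h'.2.1) (fun ψ h1 h2 h3 => ?_)
  · filter_upwards [this] with x hx hxΩ using sub_eq_zero.1 (hx hxΩ)
  obtain ⟨C, hC⟩ := h1.continuous.bounded_above_of_compact_support h2
  rw [← setIntegral_eq_integral_of_forall_compl_eq_zero (s := Ω) (fun x hx => by
    rw [image_eq_zero_of_notMem_tsupport (fun h => hx (h3 h)), zero_smul])]
  have hm : AEStronglyMeasurable ψ (volume.restrict Ω) := h1.continuous.aestronglyMeasurable
  simp only [smul_sub]
  have e3 : ∫ x in Ω, ψ x • G x - ψ x • G' x =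
      (∫ x in Ω, ψ x • G x) - ∫ x in Ω, ψ x • G' x :=
    integral_sub (hi.bdd_smul _ hm (Eventually.of_forall hC))
      (hi'.bdd_smul _ hm (Eventually.of_forall hC))
  rw [e3, sub_eq_zero]
  have e1 := h.2.2 ψ ⟨h1, h2, h3⟩
  have e2 := h'.2.2 ψ ⟨h1, h2, h3⟩
  exact neg_injective (e1.symm.trans e2)

lemma IsTestFunction.sub {Ω : Set (Sp N)} {ψ η : Sp N → ℝ} (hψ : IsTestFunction Ω ψ)
    (hη : IsTestFunction Ω η) : IsTestFunction Ω (fun x => ψ x - η x) :=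
  ⟨hψ.1.sub hη.1, hψ.2.1.sub hη.2.1,
    (tsupport_sub ψ η).trans (union_subset hψ.2.2 hη.2.2)⟩

lemma gradient_fun_sub {ψ η : Sp N → ℝ} {x : Sp N} (hψ : DifferentiableAt ℝ ψ x)
    (hη : DifferentiableAt ℝ η x) :
    gradient (fun x => ψ x - η x) x = gradient ψ x - gradient η x := by
  simp only [gradient, fderiv_fun_sub hψ hη, map_sub]

lemma IsTestLimit.sub {Ω : Set (Sp N)} {a : ENNReal} (ha : 1 ≤ a) {f f' : Sp N → ℝ}
    {G G' : Sp N → Sp N} (hf : MemLp f a (volume.restrict Ω)) (hf' : MemLp f' a (volume.restrict Ω))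
    (hG : MemLp G a (volume.restrict Ω)) (hG' : MemLp G' a (volume.restrict Ω))
    (h : IsTestLimit Ω a f G) (h' : IsTestLimit Ω a f' G') :
    IsTestLimit Ω a (fun x => f x - f' x) (fun x => G x - G' x) := by
  obtain ⟨ψ, hψ, h1, h2⟩ := h
  obtain ⟨η, hη, h1', h2'⟩ := h'
  refine ⟨fun n x => ψ n x - η n x, fun n => (hψ n).sub (hη n), ?_, ?_⟩
  · refine tendsto_eLpNorm_zero_of_le (C := 1) (c := 0) (D := f) ha
      (fun n => hf.1.sub (hψ n).1.continuous.aestronglyMeasurable)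
      (fun n => hf'.1.sub (hη n).1.continuous.aestronglyMeasurable) h1 h1' hf tendsto_const_nhds
      fun n => Eventually.of_forall fun x => ?_
    have := norm_sub_le (f x - ψ n x) (f' x - η n x)
    rw [show f x - f' x - (ψ n x - η n x) = f x - ψ n x - (f' x - η n x) by abel]
    simpa using this
  · refine tendsto_eLpNorm_zero_of_le (C := 1) (c := 0) (D := f) ha
      (fun n => hG.1.sub (hψ n).continuous_gradient.aestronglyMeasurable)
      (fun n => hG'.1.sub (hη n).continuous_gradient.aestronglyMeasurable) h2 h2' hf
      tendsto_const_nhds fun n => Eventually.of_forall fun x => ?_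
    have := norm_sub_le (G x - gradient (ψ n) x) (G' x - gradient (η n) x)
    rw [gradient_fun_sub ((hψ n).1.differentiable (by simp) x)
        ((hη n).1.differentiable (by simp) x),
      show G x - G' x - (gradient (ψ n) x - gradient (η n) x) =
        G x - gradient (ψ n) x - (G' x - gradient (η n) x) by abel]
    simpa using this

/-- A continuous function is a uniform limit of derivatives of smooth functions vanishing at `0`. -/
lemma exists_contDiff_hasDerivAt_near {k : ℝ → ℝ} (hk : Continuous k) {ε : ℝ} (hε : 0 < ε) :
    ∃ h h' : ℝ → ℝ, ContDiff ℝ ∞ h ∧ h 0 = 0 ∧ (∀ s, HasDerivAt h (h' s) s) ∧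
      ∀ s, |h' s - k s| ≤ ε := by
  obtain ⟨h', hs, hd, -⟩ := hk.exists_contDiff_approx ⊤ (continuous_const (y := ε)) (fun _ => hε)
  have hder : ∀ s, HasDerivAt (fun u => ∫ x in (0 : ℝ)..u, h' x) (h' s) s := fun s =>
    (hs.continuous.integral_hasStrictDerivAt 0 s).hasDerivAt
  refine ⟨fun u => ∫ x in (0 : ℝ)..u, h' x, h', ?_, by simp, hder, fun s => (hd s).le⟩
  rw [contDiff_infty_iff_deriv]
  exact ⟨fun s => (hder s).differentiableAt, by rwa [funext fun s => (hder s).deriv]⟩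

lemma IsTestFunction.comp {Ω : Set (Sp N)} {ψ : Sp N → ℝ} (hψ : IsTestFunction Ω ψ) {h : ℝ → ℝ}
    (hh : ContDiff ℝ ∞ h) (h0 : h 0 = 0) : IsTestFunction Ω (fun x => h (ψ x)) :=
  ⟨hh.comp hψ.1, hψ.2.1.comp_left h0, (tsupport_comp_subset h0 ψ).trans hψ.2.2⟩

lemma gradient_fun_comp {ψ : Sp N → ℝ} {h : ℝ → ℝ} {h' : ℝ} {x : Sp N}
    (hh : HasDerivAt h h' (ψ x)) (hψ : DifferentiableAt ℝ ψ x) :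
    gradient (fun x => h (ψ x)) x = h' • gradient ψ x := by
  have h2 : fderiv ℝ (fun x => h (ψ x)) x = h' • fderiv ℝ ψ x :=
    (hh.comp_hasFDerivAt x hψ.hasFDerivAt).fderiv
  simp only [gradient, h2, map_smul]

/-- Chain rule in the closure of the test functions, for an outer function with bounded Lipschitz
derivative and an inner function with bounded gradient. -/
lemma IsTestLimit.comp {Ω : Set (Sp N)} {a : ENNReal} (ha : 1 ≤ a) {f : Sp N → ℝ}
    {G : Sp N → Sp N} (hf : MemLp f a (volume.restrict Ω)) (hG : MemLp G a (volume.restrict Ω))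
    (h : IsTestLimit Ω a f G) {K : ℝ} (hK : ∀ᵐ x ∂(volume.restrict Ω), ‖G x‖ ≤ K)
    {g k : ℝ → ℝ} (hg : ∀ s, HasDerivAt g (k s) s) (hg0 : g 0 = 0) {L : ℝ}
    (hkL : ∀ s, |k s| ≤ L) (hkc : Continuous k) (hkLip : ∀ s t, |k s - k t| ≤ L * |s - t|) :
    IsTestLimit Ω a (fun x => g (f x)) (fun x => k (f x) • G x) := by
  obtain ⟨ψ, hψ, h1, h2⟩ := h
  have hpos : ∀ n : ℕ, (0 : ℝ) < 1 / (n + 1) := fun n => by positivity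
  choose q q' hq hq0 hqd hqk using fun n : ℕ => exists_contDiff_hasDerivAt_near hkc (hpos n)
  have hL : 0 ≤ L := (abs_nonneg _).trans (hkL 0)
  have hlip : ∀ (e e' : ℝ → ℝ) (C : ℝ), (∀ s, HasDerivAt e (e' s) s) → (∀ s, |e' s| ≤ C) →
      ∀ s t, |e s - e t| ≤ C * |s - t| := fun e e' C he hC s t =>
    Convex.norm_image_sub_le_of_norm_hasDerivWithin_le (s := univ)
      (fun x _ => (he x).hasDerivWithinAt) (fun x _ => hC x) convex_univ (mem_univ t) (mem_univ s)
  have hle1 : ∀ n : ℕ, (1 : ℝ) / (n + 1) ≤ 1 := fun n => by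
    rw [div_le_one (by positivity)]; linarith [Nat.cast_nonneg (α := ℝ) n]
  have hm1 : ∀ n, AEStronglyMeasurable (fun x => f x - ψ n x) (volume.restrict Ω) := fun n =>
    hf.1.sub (hψ n).1.continuous.aestronglyMeasurable
  have hm2 : ∀ n, AEStronglyMeasurable (fun x => G x - gradient (ψ n) x) (volume.restrict Ω) :=
    fun n => hG.1.sub (hψ n).continuous_gradient.aestronglyMeasurable
  refine ⟨fun n x => q n (ψ n x), fun n => (hψ n).comp (hq n) (hq0 n), ?_, ?_⟩
  · refine tendsto_eLpNorm_zero_of_le (C := L + 1) (c := fun n : ℕ => 1 / ((n : ℝ) + 1)) ha hm1 hm1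
      h1 h1 hf tendsto_one_div_add_atTop_nhds_zero_nat fun n => Eventually.of_forall fun x => ?_
    have i1 : |g (f x) - g (ψ n x)| ≤ L * |f x - ψ n x| := hlip g k L hg hkL _ _
    have i2 : |q n (ψ n x) - g (ψ n x)| ≤ 1 / ((n : ℝ) + 1) * |ψ n x| := by
      have := hlip (fun s => q n s - g s) (fun s => q' n s - k s) (1 / ((n : ℝ) + 1))
        (fun s => (hqd n s).sub (hg s)) (hqk n) (ψ n x) 0
      simpa [hq0, hg0] using this
    have i3 : |ψ n x| ≤ |f x| + |f x - ψ n x| := by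
      have := abs_sub (f x) (f x - ψ n x)
      rwa [sub_sub_cancel] at this
    have i4 : 1 / ((n : ℝ) + 1) * |ψ n x| ≤ 1 / ((n : ℝ) + 1) * |f x| + |f x - ψ n x| := by
      refine (mul_le_mul_of_nonneg_left i3 (hpos n).le).trans ?_
      have := mul_le_mul_of_nonneg_right (hle1 n) (abs_nonneg (f x - ψ n x))
      linarith
    have i5 : |g (f x) - q n (ψ n x)| ≤ |g (f x) - g (ψ n x)| + |q n (ψ n x) - g (ψ n x)| := by
      have := abs_sub (g (f x) - g (ψ n x)) (q n (ψ n x) - g (ψ n x))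
      rwa [sub_sub_sub_cancel_right] at this
    simp only [Real.norm_eq_abs]
    have : 0 ≤ (L + 1) * |f x - ψ n x| := by positivity
    linarith
  · refine tendsto_eLpNorm_zero_of_le (C := L * (|K| + 1) + 1)
      (c := fun n : ℕ => 1 / ((n : ℝ) + 1)) ha hm1 hm2
      h1 h2 hG tendsto_one_div_add_atTop_nhds_zero_nat fun n => ?_
    filter_upwards [hK] with x hx
    rw [gradient_fun_comp (hqd n _) ((hψ n).1.differentiable (by simp) x)]
    -- the middle term uses the bound on `k`, the first its Lipschitz constant and `‖G‖ ≤ K`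
    have e : k (f x) • G x - q' n (ψ n x) • gradient (ψ n) x =
        (k (f x) - k (ψ n x)) • G x + k (ψ n x) • (G x - gradient (ψ n) x) +
        (k (ψ n x) - q' n (ψ n x)) • gradient (ψ n) x := by
      simp only [sub_smul, smul_sub]; abel
    rw [e]
    refine (norm_add₃_le).trans ?_
    simp only [norm_smul, Real.norm_eq_abs]
    have j1 : |k (f x) - k (ψ n x)| * ‖G x‖ ≤ L * |f x - ψ n x| * |K| := by
      have := hkLip (f x) (ψ n x)
      have := hx.trans (le_abs_self K)
      gcongr
    have j2 : |k (ψ n x)| * ‖G x - gradient (ψ n) x‖ ≤ L * ‖G x - gradient (ψ n) x‖ := by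
      gcongr; exact hkL _
    have j3 : |k (ψ n x) - q' n (ψ n x)| * ‖gradient (ψ n) x‖ ≤
        1 / ((n : ℝ) + 1) * ‖G x‖ + ‖G x - gradient (ψ n) x‖ := by
      have i1 : ‖gradient (ψ n) x‖ ≤ ‖G x‖ + ‖G x - gradient (ψ n) x‖ := by
        have := norm_sub_le (G x) (G x - gradient (ψ n) x)
        rwa [sub_sub_cancel] at this
      have i2 := hqk n (ψ n x)
      rw [abs_sub_comm] at i2
      refine (mul_le_mul i2 i1 (norm_nonneg _) (hpos n).le).trans ?_
      have := mul_le_mul_of_nonneg_right (hle1 n) (norm_nonneg (G x - gradient (ψ n) x))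
      linarith
    have p1 : 0 ≤ L * |f x - ψ n x| := by positivity
    have p2 : 0 ≤ |f x - ψ n x| := by positivity
    have p3 : 0 ≤ L * (|K| * ‖G x - gradient (ψ n) x‖) := by positivity
    linarith

/-- Chain rule in `W_0^{1,a}(Ω)` for `1 ≤ a < ∞`. -/
lemma MemW10.comp_of_testLimit {Ω : Set (Sp N)} [IsFiniteMeasure (volume.restrict Ω)]
    {a : ENNReal} (ha : 1 ≤ a) (ha' : a ≠ ⊤) {f : Sp N → ℝ} {G : Sp N → Sp N}
    (hf : MemLp f a (volume.restrict Ω)) (hG : MemLp G a (volume.restrict Ω))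
    (h : IsTestLimit Ω a f G) {K : ℝ} (hK : ∀ᵐ x ∂(volume.restrict Ω), ‖G x‖ ≤ K)
    {g k : ℝ → ℝ} (hg : ∀ s, HasDerivAt g (k s) s) (hg0 : g 0 = 0) {L : ℝ}
    (hkL : ∀ s, |k s| ≤ L) (hkc : Continuous k) (hkLip : ∀ s t, |k s - k t| ≤ L * |s - t|) :
    MemW10 Ω a (fun x => g (f x)) (fun x => k (f x) • G x) := by
  have hlim := h.comp ha hf hG hK hg hg0 hkL hkc hkLip
  have hgc : Continuous g := continuous_iff_continuousAt.2 fun s => (hg s).continuousAt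
  have h1 : MemLp (fun x => g (f x)) a (volume.restrict Ω) := by
    refine hf.of_le_mul (c := L) (hgc.comp_aestronglyMeasurable hf.1)
      (Eventually.of_forall fun x => ?_)
    have := Convex.norm_image_sub_le_of_norm_hasDerivWithin_le (s := univ) (f := g) (f' := k)
      (fun x _ => (hg x).hasDerivWithinAt) (fun x _ => hkL x) convex_univ (mem_univ 0)
      (mem_univ (f x))
    simpa [hg0] using this
  have h2 : MemLp (fun x => k (f x) • G x) a (volume.restrict Ω) := by
    refine hG.of_le_mul (c := L) ((hkc.comp_aestronglyMeasurable hf.1).smul hG.1)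
      (Eventually.of_forall fun x => ?_)
    rw [norm_smul]
    exact mul_le_mul_of_nonneg_right (hkL _) (norm_nonneg _)
  exact ⟨⟨h1, h2, hlim.hasWeakGradient ha h1 h2⟩, by simpa [ha'] using hlim⟩

/-! ### Weak time derivatives -/

lemma restrict_cyl (Ω : Set (Sp N)) (T : ℝ) :
    (volume : Measure (ℝ × Sp N)).restrict (Cyl Ω T) =
      (volume.restrict (Ioo 0 T)).prod (volume.restrict Ω) := by
  rw [Measure.prod_restrict]; rfl

lemma IsTestFunction.mul_prod {Ω : Set (Sp N)} {T : ℝ} {a : ℝ → ℝ} {b : Sp N → ℝ}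
    (ha : IsTestFunction (Ioo 0 T) a) (hb : IsTestFunction Ω b) :
    IsTestFunction (Cyl Ω T) (fun z => a z.1 * b z.2) := by
  have hsub : tsupport (fun z : ℝ × Sp N => a z.1 * b z.2) ⊆ tsupport a ×ˢ tsupport b := by
    refine closure_minimal (fun z hz => ?_) ((isClosed_tsupport a).prod (isClosed_tsupport b))
    have := mul_ne_zero_iff.1 hz
    exact ⟨subset_tsupport a this.1, subset_tsupport b this.2⟩
  refine ⟨(ha.1.comp contDiff_fst).mul (hb.1.comp contDiff_snd), ?_, hsub.trans
    (prod_mono ha.2.2 hb.2.2)⟩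
  exact (ha.2.1.isCompact.prod hb.2.1.isCompact).of_isClosed_subset (isClosed_tsupport _) hsub

/-- Testing the weak time derivative with products `a(t) b(x)` gives, for each `a`, the
one-dimensional weak formulation on almost every vertical line. -/
lemma HasWeakTimeDeriv.ae_integral_eq_zero {Ω : Set (Sp N)} (hΩ : IsOpen Ω) {T : ℝ}
    {u ut : ℝ × Sp N → ℝ} (h : HasWeakTimeDeriv Ω T u ut) (hu : IntegrableOn u (Cyl Ω T))
    (hut : IntegrableOn ut (Cyl Ω T)) {a : ℝ → ℝ} (ha : IsTestFunction (Ioo 0 T) a) :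
    ∀ᵐ x ∂(volume.restrict Ω),
      ∫ t in Ioo 0 T, (u (t, x) * deriv a t + ut (t, x) * a t) = 0 := by
  have ha' : Continuous (deriv a) := ha.1.continuous_deriv (by simp)
  obtain ⟨C, hC⟩ := ha.1.continuous.bounded_above_of_compact_support ha.2.1
  obtain ⟨C', hC'⟩ := ha'.bounded_above_of_compact_support ha.2.1.deriv
  have i1 : IntegrableOn (fun z : ℝ × Sp N => u z * deriv a z.1) (Cyl Ω T) :=
    hu.mul_bdd (ha'.comp continuous_fst).aestronglyMeasurable
      (Eventually.of_forall fun z => hC' z.1)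
  have i2 : IntegrableOn (fun z : ℝ × Sp N => ut z * a z.1) (Cyl Ω T) :=
    hut.mul_bdd (ha.1.continuous.comp continuous_fst).aestronglyMeasurable
      (Eventually.of_forall fun z => hC z.1)
  have i3 := i1.add i2
  rw [IntegrableOn, restrict_cyl] at i3
  have i4 := i3.integral_prod_right
  rw [ae_restrict_iff' hΩ.measurableSet]
  refine hΩ.ae_eq_zero_of_integral_contDiff_smul_eq_zero (μ := volume)
    (f := fun x => ∫ t in Ioo 0 T, (u (t, x) * deriv a t + ut (t, x) * a t))
    (IntegrableOn.locallyIntegrableOn i4) fun b b1 b2 b3 => ?_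
  have hb : IsTestFunction Ω b := ⟨b1, b2, b3⟩
  obtain ⟨B, hB⟩ := b1.continuous.bounded_above_of_compact_support b2
  have hbm : AEStronglyMeasurable (fun z : ℝ × Sp N => b z.2) (volume.restrict (Cyl Ω T)) :=
    (b1.continuous.comp continuous_snd).aestronglyMeasurable
  have j1 := i1.mul_bdd hbm (Eventually.of_forall fun z => hB z.2)
  have j2 := i2.mul_bdd hbm (Eventually.of_forall fun z => hB z.2)
  have j3 := j1.add j2
  rw [restrict_cyl] at j3
  rw [← setIntegral_eq_integral_of_forall_compl_eq_zero (s := Ω) (fun x hx => by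
    rw [image_eq_zero_of_notMem_tsupport (fun h => hx (b3 h)), zero_smul])]
  have e1 : ∫ x in Ω, b x • ∫ t in Ioo 0 T, (u (t, x) * deriv a t + ut (t, x) * a t) =
      ∫ z in Cyl Ω T, (u z * deriv a z.1 * b z.2 + ut z * a z.1 * b z.2) := by
    rw [restrict_cyl]
    refine Eq.trans ?_ (integral_prod_symm _ j3).symm
    refine integral_congr_ae (Eventually.of_forall fun x => ?_)
    simp only [smul_eq_mul, Pi.add_apply]
    rw [← integral_const_mul]
    congr 1; ext t; ring
  have e2 := h.2.2 _ (ha.mul_prod hb)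
  have e3 : ∀ z : ℝ × Sp N, fderiv ℝ (fun z : ℝ × Sp N => a z.1 * b z.2) z (1, 0) =
      deriv a z.1 * b z.2 := fun z => by
    have d1 : HasFDerivAt (fun z : ℝ × Sp N => a z.1)
        ((deriv a z.1) • ContinuousLinearMap.fst ℝ ℝ (Sp N)) z :=
      (ha.1.differentiable (by simp) z.1).hasDerivAt.comp_hasFDerivAt z hasFDerivAt_fst
    have d2 : HasFDerivAt (fun z : ℝ × Sp N => b z.2)
        ((fderiv ℝ b z.2).comp (ContinuousLinearMap.snd ℝ ℝ (Sp N))) z :=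
      (b1.differentiable (by simp) z.2).hasFDerivAt.comp z hasFDerivAt_snd
    have d3 : HasFDerivAt (fun z : ℝ × Sp N => a z.1 * b z.2) _ z := d1.mul d2
    rw [d3.fderiv]
    simp [mul_comm]
  simp only [e3] at e2
  rw [e1, integral_add j1 j2]
  have e4 : ∀ z : ℝ × Sp N, u z * deriv a z.1 * b z.2 = u z * (deriv a z.1 * b z.2) := fun z =>
    mul_assoc _ _ _
  have e5 : ∀ z : ℝ × Sp N, ut z * a z.1 * b z.2 = ut z * (a z.1 * b z.2) := fun z =>
    mul_assoc _ _ _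
  simp only [e4, e5, e2, neg_add_cancel]

/-- A smooth approximation of the Heaviside function jumping at `τ`, with transition layer
`[τ, τ + δ]`. -/
noncomputable def smoothStep (δ τ t : ℝ) : ℝ := Real.smoothTransition (δ⁻¹ * (t - τ))

lemma contDiff_smoothStep (δ τ : ℝ) : ContDiff ℝ ∞ (smoothStep δ τ) :=
  Real.smoothTransition.contDiff.comp (contDiff_const.mul (contDiff_id.sub contDiff_const))

lemma smoothStep_of_le {δ τ t : ℝ} (hδ : 0 < δ) (h : t ≤ τ) : smoothStep δ τ t = 0 :=
  Real.smoothTransition.zero_of_nonpos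
    (mul_nonpos_of_nonneg_of_nonpos (by positivity) (by linarith))

lemma smoothStep_of_ge {δ τ t : ℝ} (hδ : 0 < δ) (h : τ + δ ≤ t) : smoothStep δ τ t = 1 := by
  refine Real.smoothTransition.one_of_one_le ?_
  rw [inv_mul_eq_div, le_div_iff₀ hδ]; linarith

lemma deriv_smoothStep (δ τ t : ℝ) :
    deriv (smoothStep δ τ) t = δ⁻¹ * deriv Real.smoothTransition (δ⁻¹ * (t - τ)) := by
  have h1 : HasDerivAt (fun t => δ⁻¹ * (t - τ)) (δ⁻¹ * 1) t :=
    ((hasDerivAt_id t).sub_const τ).const_mul _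
  have h2 := (((Real.smoothTransition.contDiff (n := 1)).differentiable (by simp))
    (δ⁻¹ * (t - τ))).hasDerivAt.comp t h1
  rw [mul_one, mul_comm] at h2
  exact h2.deriv

lemma continuous_deriv_smoothTransition : Continuous (deriv Real.smoothTransition) :=
  (Real.smoothTransition.contDiff (n := 1)).continuous_deriv (by simp)

lemma deriv_smoothTransition_of_notMem {s : ℝ} (hs : s ∉ Icc (0 : ℝ) 1) :
    deriv Real.smoothTransition s = 0 := by
  rw [mem_Icc, not_and_or, not_le, not_le] at hs
  rcases hs with hs | hs
  · have : Real.smoothTransition =ᶠ[𝓝 s] fun _ => 0 := by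
      filter_upwards [Iio_mem_nhds hs] with y hy
        using Real.smoothTransition.zero_of_nonpos (le_of_lt hy)
    rw [this.deriv_eq, deriv_const]
  · have : Real.smoothTransition =ᶠ[𝓝 s] fun _ => 1 := by
      filter_upwards [Ioi_mem_nhds hs] with y hy
        using Real.smoothTransition.one_of_one_le (le_of_lt hy)
    rw [this.deriv_eq, deriv_const]

/-- The derivatives of the smooth steps form an approximate identity. -/
lemma tendsto_integral_mul_deriv_smoothStep {T M τ : ℝ} (hτ : τ ∈ Ioo 0 T) {e : ℝ → ℝ}
    (he : ContinuousOn e (Ioo 0 T)) (hM : ∀ t ∈ Ioo 0 T, |e t| ≤ M) {δ : ℕ → ℝ}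
    (hδ : ∀ n, 0 < δ n) (hδT : ∀ n, τ + δ n < T) (hδ0 : Tendsto δ atTop (𝓝 0)) :
    Tendsto (fun n => ∫ t in Ioo 0 T, e t * deriv (smoothStep (δ n) τ) t) atTop (𝓝 (e τ)) := by
  have hmem : ∀ n, ∀ s ∈ Icc (0 : ℝ) 1, δ n * s + τ ∈ Ioo 0 T := fun n s hs => by
    have := mul_nonneg (hδ n).le hs.1
    have := mul_le_mul_of_nonneg_left hs.2 (hδ n).le
    exact ⟨by linarith [hτ.1], by linarith [hδT n]⟩
  have hsub : ∀ n, ∫ t in Ioo 0 T, e t * deriv (smoothStep (δ n) τ) t =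
      ∫ s in (0 : ℝ)..1, e (δ n * s + τ) * deriv Real.smoothTransition s := by
    intro n
    have h1 : ∫ t in Ioo 0 T, e t * deriv (smoothStep (δ n) τ) t =
        ∫ t in Icc τ (τ + δ n), e t * deriv (smoothStep (δ n) τ) t := by
      refine setIntegral_eq_of_subset_of_forall_sdiff_eq_zero measurableSet_Ioo ?_ ?_
      · exact fun t ht => ⟨hτ.1.trans_le ht.1, ht.2.trans_lt (hδT n)⟩
      · intro t ht
        rw [deriv_smoothStep, deriv_smoothTransition_of_notMem, mul_zero, mul_zero]
        refine fun hs => ht.2 ?_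
        rw [inv_mul_eq_div, mem_Icc, le_div_iff₀ (hδ n), div_le_iff₀ (hδ n)] at hs
        exact ⟨by linarith [hs.1], by linarith [hs.2]⟩
    rw [h1, integral_Icc_eq_integral_Ioc, ← intervalIntegral.integral_of_le
      (by linarith [hδ n])]
    have h2 := intervalIntegral.integral_comp_mul_add (a := 0) (b := 1)
      (fun t => e t * deriv Real.smoothTransition ((δ n)⁻¹ * (t - τ))) (hδ n).ne' τ
    have h3 : ∀ s, (δ n)⁻¹ * (δ n * s + τ - τ) = s := fun s => by
      rw [add_sub_cancel_right, inv_mul_cancel_left₀ (hδ n).ne']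
    simp only [h3] at h2
    rw [h2, smul_eq_mul, ← intervalIntegral.integral_const_mul]
    simp only [deriv_smoothStep, mul_zero, zero_add, mul_one, add_comm τ]
    congr 1; ext t; ring
  simp only [hsub]
  have hlim : ∫ s in (0 : ℝ)..1, e τ * deriv Real.smoothTransition s = e τ := by
    rw [intervalIntegral.integral_const_mul, intervalIntegral.integral_deriv_eq_sub
      (fun x _ => (Real.smoothTransition.contDiff (n := 1)).differentiable (by simp) x)
      (continuous_deriv_smoothTransition.intervalIntegrable _ _)]
    simp
  rw [← hlim]
  refine intervalIntegral.tendsto_integral_filter_of_dominated_convergence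
    (fun s => M * |deriv Real.smoothTransition s|) ?_ ?_ ?_ ?_
  · refine Eventually.of_forall fun n => ContinuousOn.aestronglyMeasurable ?_ measurableSet_uIoc
    refine (he.comp (by fun_prop) fun s hs => ?_).mul continuous_deriv_smoothTransition.continuousOn
    rw [uIoc_of_le zero_le_one] at hs
    exact hmem n s (Ioc_subset_Icc_self hs)
  · refine Eventually.of_forall fun n => Eventually.of_forall fun s hs => ?_
    rw [uIoc_of_le zero_le_one] at hs
    rw [Real.norm_eq_abs, abs_mul]
    exact mul_le_mul_of_nonneg_right (hM _ (hmem n s (Ioc_subset_Icc_self hs))) (abs_nonneg _)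
  · exact (continuous_const.mul continuous_deriv_smoothTransition.abs).intervalIntegrable _ _
  · refine Eventually.of_forall fun s hs => Tendsto.mul_const _ ?_
    have h1 : Tendsto (fun n => δ n * s + τ) atTop (𝓝 τ) := by
      simpa using (hδ0.mul_const s).add_const τ
    exact (he.continuousAt (isOpen_Ioo.mem_nhds hτ)).tendsto.comp h1

lemma tendsto_integral_mul_smoothStep {T τ : ℝ} (hτ : τ ∈ Ioo 0 T) {f : ℝ → ℝ}
    (hf : IntegrableOn f (Ioo 0 T)) {δ : ℕ → ℝ}
    (hδ : ∀ n, 0 < δ n) (hδ0 : Tendsto δ atTop (𝓝 0)) :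
    Tendsto (fun n => ∫ t in Ioo 0 T, f t * smoothStep (δ n) τ t) atTop
      (𝓝 (∫ t in τ..T, f t)) := by
  have hlim : ∫ t in τ..T, f t = ∫ t in Ioo 0 T, (Ioi τ).indicator f t := by
    rw [intervalIntegral.integral_of_le hτ.2.le, integral_Ioc_eq_integral_Ioo,
      setIntegral_indicator measurableSet_Ioi]
    congr 2; ext t
    exact ⟨fun h => ⟨⟨hτ.1.trans h.1, h.2⟩, h.1⟩, fun h => ⟨h.2, h.1.2⟩⟩
  rw [hlim]
  refine tendsto_integral_of_dominated_convergence (fun t => ‖f t‖) (fun n => ?_) hf.norm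
    (fun n => Eventually.of_forall fun t => ?_) (Eventually.of_forall fun t => ?_)
  · exact hf.1.mul (contDiff_smoothStep _ _).continuous.aestronglyMeasurable
  · rw [norm_mul, Real.norm_eq_abs (smoothStep _ _ _), smoothStep,
      abs_of_nonneg (Real.smoothTransition.nonneg _)]
    exact mul_le_of_le_one_right (norm_nonneg _) (Real.smoothTransition.le_one _)
  · by_cases ht : τ < t
    · rw [indicator_of_mem (mem_Ioi.2 ht)]
      refine tendsto_const_nhds.congr' ?_
      filter_upwards [hδ0.eventually_lt_const (sub_pos.2 ht)] with n hn
      rw [smoothStep_of_ge (hδ n) (by linarith), mul_one]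
    · rw [indicator_of_notMem (by simpa using ht)]
      refine tendsto_const_nhds.congr fun n => ?_
      rw [smoothStep_of_le (hδ n) (not_lt.1 ht), mul_zero]

lemma isTestFunction_smoothStep_sub {T δ τ σ : ℝ} (hδ : 0 < δ) (hτ : τ ∈ Ioo 0 T)
    (hσ : σ ∈ Ioo 0 T) (hτT : τ + δ < T) (hσT : σ + δ < T) :
    IsTestFunction (Ioo 0 T) (fun t => smoothStep δ τ t - smoothStep δ σ t) := by
  have hsub : tsupport (fun t => smoothStep δ τ t - smoothStep δ σ t) ⊆
      Icc (min τ σ) (max τ σ + δ) := by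
    refine closure_minimal (fun t ht => ?_) isClosed_Icc
    by_contra hn
    rw [mem_Icc, not_and_or, not_le, not_le] at hn
    refine ht ?_
    rcases hn with hn | hn
    · have := lt_min_iff.1 hn
      simp [smoothStep_of_le hδ this.1.le, smoothStep_of_le hδ this.2.le]
    · have h1 := le_max_left τ σ
      have h2 := le_max_right τ σ
      simp [smoothStep_of_ge hδ (by linarith : τ + δ ≤ t),
        smoothStep_of_ge hδ (by linarith : σ + δ ≤ t)]
  refine ⟨(contDiff_smoothStep _ _).sub (contDiff_smoothStep _ _),
    isCompact_Icc.of_isClosed_subset (isClosed_tsupport _) hsub, hsub.trans fun t ht => ⟨?_, ?_⟩⟩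
  · exact (lt_min hτ.1 hσ.1).trans_le ht.1
  · refine ht.2.trans_lt ?_
    rcases max_cases τ σ with h | h <;> rw [h.1] <;> assumption

/-- On almost every vertical line, a continuous function with integrable weak time derivative is
the primitive of that derivative. -/
lemma HasWeakTimeDeriv.ae_eq_add_integral {Ω : Set (Sp N)} (hΩ : IsOpen Ω) {T : ℝ} (hT : 0 < T)
    {u ut : ℝ × Sp N → ℝ} (h : HasWeakTimeDeriv Ω T u ut) (hu : IntegrableOn u (Cyl Ω T))
    (hut : IntegrableOn ut (Cyl Ω T)) (hc : ContinuousOn u (Ico 0 T ×ˢ closure Ω)) {M : ℝ}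
    (hM : ∀ z ∈ Ico 0 T ×ˢ closure Ω, |u z| ≤ M) :
    ∀ᵐ x ∂(volume.restrict Ω), IntegrableOn (fun t => ut (t, x)) (Ioo 0 T) ∧
      ∀ t ∈ Ico 0 T, u (t, x) = u (0, x) + ∫ s in (0 : ℝ)..t, ut (s, x) := by
  -- countably many test functions in time suffice: jumps at rational times, layers of width `c/n`
  let δ : ℚ → ℚ → ℕ → ℝ := fun τ σ n => min (T - τ) (T - σ) / (n + 2)
  have key : ∀ᵐ x ∂(volume.restrict Ω), ∀ (τ σ : ℚ) (n : ℕ), (τ : ℝ) ∈ Ioo 0 T →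
      (σ : ℝ) ∈ Ioo 0 T → ∫ t in Ioo 0 T,
        (u (t, x) * deriv (fun t => smoothStep (δ τ σ n) τ t - smoothStep (δ τ σ n) σ t) t +
          ut (t, x) * (smoothStep (δ τ σ n) τ t - smoothStep (δ τ σ n) σ t)) = 0 := by
    simp only [ae_all_iff]
    intro τ σ n hτ hσ
    have hm : 0 < min (T - τ) (T - σ) := lt_min (by linarith [hτ.2]) (by linarith [hσ.2])
    have hlt : δ τ σ n < min (T - τ) (T - σ) :=
      div_lt_self hm (by linarith [Nat.cast_nonneg (α := ℝ) n])
    have := lt_min_iff.1 hlt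
    exact h.ae_integral_eq_zero hΩ hu hut (isTestFunction_smoothStep_sub
      (by positivity) hτ hσ (by linarith) (by linarith))
  have hut' : ∀ᵐ x ∂(volume.restrict Ω), IntegrableOn (fun t => ut (t, x)) (Ioo 0 T) := by
    rw [IntegrableOn, restrict_cyl] at hut
    exact hut.prod_left_ae
  have hxΩ : ∀ᵐ x ∂(volume.restrict Ω), x ∈ Ω := ae_restrict_mem hΩ.measurableSet
  filter_upwards [key, hut', hxΩ] with x hx hxi hxΩ
  refine ⟨hxi, ?_⟩
  have hux : ContinuousOn (fun t => u (t, x)) (Ico 0 T) :=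
    hc.comp (by fun_prop) fun t ht => ⟨ht, subset_closure hxΩ⟩
  have hux' : ContinuousOn (fun t => u (t, x)) (Ioo 0 T) := hux.mono Ioo_subset_Ico_self
  have hMx : ∀ t ∈ Ioo 0 T, |u (t, x)| ≤ M := fun t ht =>
    hM _ ⟨Ioo_subset_Ico_self ht, subset_closure hxΩ⟩
  have hrat : ∀ τ σ : ℚ, (τ : ℝ) ∈ Ioo 0 T → (σ : ℝ) ∈ Ioo 0 T →
      u (τ, x) + ∫ s in (τ : ℝ)..T, ut (s, x) = u (σ, x) + ∫ s in (σ : ℝ)..T, ut (s, x) := by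
    intro τ σ hτ hσ
    have hm : 0 < min (T - τ) (T - σ) := lt_min (by linarith [hτ.2]) (by linarith [hσ.2])
    have hδ : ∀ n, 0 < δ τ σ n := fun n => by positivity
    have hδT : ∀ n, τ + δ τ σ n < T ∧ σ + δ τ σ n < T := fun n => by
      have hlt : δ τ σ n < min (T - τ) (T - σ) :=
        div_lt_self hm (by linarith [Nat.cast_nonneg (α := ℝ) n])
      have := lt_min_iff.1 hlt
      exact ⟨by linarith, by linarith⟩
    have hδ0 : Tendsto (δ τ σ) atTop (𝓝 0) :=
      tendsto_const_nhds.div_atTop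
        (tendsto_atTop_add_const_right _ _ tendsto_natCast_atTop_atTop)
    have l1 := tendsto_integral_mul_deriv_smoothStep hτ hux' hMx hδ (fun n => (hδT n).1) hδ0
    have l2 := tendsto_integral_mul_deriv_smoothStep hσ hux' hMx hδ (fun n => (hδT n).2) hδ0
    have l3 := tendsto_integral_mul_smoothStep hτ hxi hδ hδ0
    have l4 := tendsto_integral_mul_smoothStep hσ hxi hδ hδ0
    have hui : IntegrableOn (fun t => u (t, x)) (Ioo 0 T) :=
      IntegrableOn.of_bound measure_Ioo_lt_top (hux'.aestronglyMeasurable measurableSet_Ioo) M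
        ((ae_restrict_iff' measurableSet_Ioo).2 (Eventually.of_forall hMx))
    have hdi : ∀ n (ρ : ℝ), ρ ∈ Ioo 0 T →
        IntegrableOn (fun t => u (t, x) * deriv (smoothStep (δ τ σ n) ρ) t) (Ioo 0 T) := by
      intro n ρ _
      have hdc : Continuous (deriv (smoothStep (δ τ σ n) ρ)) :=
        (contDiff_smoothStep _ _).continuous_deriv (by simp)
      obtain ⟨B, hB⟩ := isCompact_Icc.exists_bound_of_continuousOn (s := Icc 0 T) hdc.continuousOn
      exact hui.mul_bdd hdc.aestronglyMeasurable ((ae_restrict_iff' measurableSet_Ioo).2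
        (Eventually.of_forall fun t ht => hB t (Ioo_subset_Icc_self ht)))
    have hsi : ∀ n (ρ : ℝ),
        IntegrableOn (fun t => ut (t, x) * smoothStep (δ τ σ n) ρ t) (Ioo 0 T) := fun n ρ =>
      hxi.mul_bdd (c := 1) (contDiff_smoothStep _ _).continuous.aestronglyMeasurable
        (Eventually.of_forall fun t => by
          rw [Real.norm_eq_abs, smoothStep, abs_of_nonneg (Real.smoothTransition.nonneg _)]
          exact Real.smoothTransition.le_one _)
    have hzero : ∀ n, (∫ t in Ioo 0 T, u (t, x) * deriv (smoothStep (δ τ σ n) τ) t) -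
        (∫ t in Ioo 0 T, u (t, x) * deriv (smoothStep (δ τ σ n) σ) t) +
        ((∫ t in Ioo 0 T, ut (t, x) * smoothStep (δ τ σ n) τ t) -
        ∫ t in Ioo 0 T, ut (t, x) * smoothStep (δ τ σ n) σ t) = 0 := by
      intro n
      refine Eq.trans ?_ (hx τ σ n hτ hσ)
      rw [← integral_sub (hdi n τ hτ) (hdi n σ hσ), ← integral_sub (hsi n τ) (hsi n σ)]
      refine (integral_add ((hdi n τ hτ).sub (hdi n σ hσ))
        ((hsi n τ).sub (hsi n σ))).symm.trans ?_
      refine integral_congr_ae (Eventually.of_forall fun t => ?_)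
      have hd : deriv (fun t => smoothStep (δ τ σ n) τ t - smoothStep (δ τ σ n) σ t) t =
          deriv (smoothStep (δ τ σ n) τ) t - deriv (smoothStep (δ τ σ n) σ) t :=
        deriv_fun_sub ((contDiff_smoothStep _ _).differentiable (by simp) t)
          ((contDiff_smoothStep _ _).differentiable (by simp) t)
      simp only [hd, Pi.sub_apply]; ring
    have := tendsto_nhds_unique (tendsto_const_nhds.congr fun n => (hzero n).symm)
      ((l1.sub l2).add (l3.sub l4))
    linarith
  have hii : IntegrableOn (fun t => ut (t, x)) (Icc 0 T) :=
    (integrableOn_Icc_iff_integrableOn_Ioo).2 hxi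
  have hiv : ∀ a ∈ Icc 0 T, ∀ b ∈ Icc 0 T,
      IntervalIntegrable (fun t => ut (t, x)) volume a b := fun a ha b hb =>
    (hii.mono_set (uIcc_subset_Icc ha hb)).intervalIntegrable
  have h0T : (0 : ℝ) ∈ Icc 0 T := ⟨le_rfl, hT.le⟩
  have hTT : T ∈ Icc 0 T := ⟨hT.le, le_rfl⟩
  have hFc : ContinuousOn (fun t => u (t, x) - ∫ s in (0 : ℝ)..t, ut (s, x)) (Ico 0 T) := by
    refine hux.sub ?_
    have := intervalIntegral.continuousOn_primitive_interval (μ := volume)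
      (f := fun t => ut (t, x)) (a := 0) (b := T) (by rwa [uIcc_of_le hT.le])
    rw [uIcc_of_le hT.le] at this
    exact this.mono Ico_subset_Icc_self
  obtain ⟨ρ, hρ0, hρT⟩ := exists_rat_btwn hT
  have hρ : (ρ : ℝ) ∈ Ioo 0 T := ⟨hρ0, hρT⟩
  have hsplit : ∀ a ∈ Icc 0 T, (∫ s in (0 : ℝ)..a, ut (s, x)) + ∫ s in a..T, ut (s, x) =
      ∫ s in (0 : ℝ)..T, ut (s, x) := fun a ha =>
    intervalIntegral.integral_add_adjacent_intervals (hiv 0 h0T a ha) (hiv a ha T hTT)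
  have hconst : EqOn (fun t => u (t, x) - ∫ s in (0 : ℝ)..t, ut (s, x))
      (fun _ => u (ρ, x) - ∫ s in (0 : ℝ)..ρ, ut (s, x)) (Ico 0 T) := by
    refine EqOn.of_subset_closure (s := Ioo 0 T ∩ range ((↑) : ℚ → ℝ)) ?_ hFc
      continuousOn_const (inter_subset_left.trans Ioo_subset_Ico_self) ?_
    · rintro _ ⟨hτ, τ, rfl⟩
      have := hrat τ ρ hτ hρ
      have h1 := hsplit τ (Ioo_subset_Icc_self hτ)
      have h2 := hsplit ρ (Ioo_subset_Icc_self hρ)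
      simp only
      linarith
    · rw [closure_ordConnected_inter_rat ordConnected_Ioo (Ioo_infinite hT).nontrivial,
        closure_Ioo hT.ne]
      exact Ico_subset_Icc_self
  intro t ht
  have e1 := hconst ht
  have e2 := hconst (show (0 : ℝ) ∈ Ico 0 T from ⟨le_rfl, hT⟩)
  simp only [intervalIntegral.integral_same, sub_zero] at e1 e2
  linarith

/-! ### Absolutely continuous functions -/

lemma _root_.AbsolutelyContinuousOnInterval.comp_lipschitzOnWith {f g : ℝ → ℝ} {a b : ℝ} {s : Set ℝ}
    {K : NNReal} (hg : LipschitzOnWith K g s) (hf : AbsolutelyContinuousOnInterval f a b)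
    (hs : ∀ t ∈ uIcc a b, f t ∈ s) : AbsolutelyContinuousOnInterval (fun t => g (f t)) a b := by
  rw [absolutelyContinuousOnInterval_iff] at hf ⊢
  intro ε hε
  obtain ⟨δ, hδ, h⟩ := hf (ε / (K + 1)) (by positivity)
  refine ⟨δ, hδ, fun E hE hEδ => ?_⟩
  have hlt := h E hE hEδ
  have hle : ∑ i ∈ Finset.range E.1, dist (g (f (E.2 i).1)) (g (f (E.2 i).2)) ≤
      K * ∑ i ∈ Finset.range E.1, dist (f (E.2 i).1) (f (E.2 i).2) := by
    rw [Finset.mul_sum]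
    refine Finset.sum_le_sum fun i hi => ?_
    have := hE.1 i hi
    exact hg.dist_le_mul _ (hs _ this.1) _ (hs _ this.2)
  have h0 : 0 ≤ ∑ i ∈ Finset.range E.1, dist (f (E.2 i).1) (f (E.2 i).2) :=
    Finset.sum_nonneg fun _ _ => dist_nonneg
  rw [lt_div_iff₀ (by positivity)] at hlt
  linarith

/-- Chain rule for the primitive of an integrable function. -/
lemma sub_eq_integral_comp_primitive {τ c M : ℝ} (hτ : 0 ≤ τ) {f : ℝ → ℝ}
    (hf : IntervalIntegrable f volume 0 τ)
    (hM : ∀ t ∈ Icc 0 τ, |c + ∫ s in (0 : ℝ)..t, f s| ≤ M) {G g : ℝ → ℝ}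
    (hG : ∀ s, HasDerivAt G (g s) s) (hg : Continuous g) :
    G (c + ∫ s in (0 : ℝ)..τ, f s) - G c =
      ∫ t in (0 : ℝ)..τ, g (c + ∫ s in (0 : ℝ)..t, f s) * f t := by
  set F : ℝ → ℝ := fun t => c + ∫ s in (0 : ℝ)..t, f s with hF
  have hFac : AbsolutelyContinuousOnInterval F 0 τ := by
    have h1 : AbsolutelyContinuousOnInterval (fun _ : ℝ => c) 0 τ :=
      (LipschitzWith.const c).lipschitzOnWith.absolutelyContinuousOnInterval
    exact h1.add (hf.absolutelyContinuousOnInterval_intervalIntegral left_mem_uIcc)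
  obtain ⟨L, hL⟩ := isCompact_Icc.exists_bound_of_continuousOn (s := Icc (-M) M) hg.continuousOn
  have hlip : LipschitzOnWith L.toNNReal G (Icc (-M) M) := by
    refine (convex_Icc _ _).lipschitzOnWith_of_nnnorm_hasDerivWithin_le (f' := g)
      (fun s _ => (hG s).hasDerivWithinAt) fun s hs => ?_
    rw [← NNReal.coe_le_coe, coe_nnnorm]
    exact (hL s hs).trans (Real.le_coe_toNNReal L)
  have hac := hFac.comp_lipschitzOnWith hlip fun t ht => by
    rw [uIcc_of_le hτ] at ht
    exact abs_le.1 (hM t ht)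
  have e := hac.integral_deriv_eq_sub
  have hF0 : F 0 = c := by simp [hF]
  rw [hF0] at e
  rw [← e]
  refine intervalIntegral.integral_congr_ae ?_
  filter_upwards [hf.ae_hasDerivAt_integral] with t ht hts
  have h1 := ht (uIoc_subset_uIcc hts) 0 left_mem_uIcc
  exact ((hG (F t)).comp t (h1.const_add c)).deriv

/-! ### Powers of the positive part and an integral Gronwall inequality -/

lemma hasDerivAt_max_zero_sq (s : ℝ) :
    HasDerivAt (fun s : ℝ => (max s 0) ^ 2) (2 * max s 0) s := by
  rcases lt_trichotomy s 0 with h | rfl | h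
  · rw [max_eq_right h.le, mul_zero]
    refine (hasDerivAt_const s (0 : ℝ)).congr_of_eventuallyEq ?_
    filter_upwards [Iio_mem_nhds h] with y hy
    rw [max_eq_right (le_of_lt hy)]; norm_num
  · rw [max_self, mul_zero]
    rw [hasDerivAt_iff_isLittleO]
    simp only [sub_zero, smul_zero, max_self, ne_eq, OfNat.ofNat_ne_zero, not_false_eq_true,
      zero_pow]
    have h1 : (fun s : ℝ => (max s 0) ^ 2) =O[𝓝 0] fun s => s ^ 2 := by
      refine Asymptotics.IsBigO.of_bound 1 (Eventually.of_forall fun s => ?_)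
      rw [one_mul, norm_pow, norm_pow]
      refine pow_le_pow_left₀ (norm_nonneg _) ?_ 2
      rw [Real.norm_eq_abs, Real.norm_eq_abs, abs_of_nonneg (le_max_right _ _)]
      exact max_le (le_abs_self s) (abs_nonneg s)
    exact h1.trans_isLittleO (Asymptotics.isLittleO_pow_id one_lt_two)
  · rw [max_eq_left h.le]
    have h1 : HasDerivAt (fun s : ℝ => s ^ 2) (2 * s) s := by simpa using hasDerivAt_pow 2 s
    refine h1.congr_of_eventuallyEq ?_
    filter_upwards [Ioi_mem_nhds h] with y hy
    rw [max_eq_left (le_of_lt hy)]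

lemma hasDerivAt_max_zero_cube (s : ℝ) :
    HasDerivAt (fun s : ℝ => (max s 0) ^ 3) (3 * (max s 0) ^ 2) s := by
  have h := (hasDerivAt_id s).mul (hasDerivAt_max_zero_sq s)
  have e1 : ∀ s : ℝ, s * max s 0 = max s 0 ^ 2 := fun s => by
    rcases le_total s 0 with h | h
    · rw [max_eq_right h]; simp
    · rw [max_eq_left h]; ring
  have e2 : ∀ s : ℝ, (max s 0) ^ 3 = s * (max s 0) ^ 2 := fun s => by
    rw [pow_succ, pow_two, ← mul_assoc, e1]; ring
  have e3 : 3 * (max s 0) ^ 2 = 1 * (max s 0) ^ 2 + s * (2 * max s 0) := by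
    rw [mul_left_comm, e1]; ring
  rw [e3, funext e2]
  exact h

/-- The derivative of the outer function used for the test functions: twice the positive part,
truncated at height `M` so as to be bounded. -/
noncomputable def truncPos (M s : ℝ) : ℝ := 2 * min (max s 0) M

/-- The primitive of `truncPos M`; it equals `(max s 0) ^ 2` for `s ≤ M`. -/
noncomputable def truncSq (M s : ℝ) : ℝ := ∫ x in (0 : ℝ)..s, truncPos M x

lemma truncPos_eq {M s : ℝ} (h : max s 0 ≤ M) : truncPos M s = 2 * max s 0 := by
  rw [truncPos, min_eq_left h]

lemma continuous_truncPos (M : ℝ) : Continuous (truncPos M) := by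
  unfold truncPos; fun_prop

lemma abs_truncPos_le {M : ℝ} (hM : 0 ≤ M) (s : ℝ) : |truncPos M s| ≤ 2 * M := by
  have h : 0 ≤ min (max s 0) M := le_min (le_max_right _ _) hM
  rw [truncPos, abs_of_nonneg (by positivity)]
  exact mul_le_mul_of_nonneg_left (min_le_right _ _) zero_le_two

lemma abs_truncPos_sub_le (M s t : ℝ) : |truncPos M s - truncPos M t| ≤ 2 * |s - t| := by
  have h := ((LipschitzWith.id.max_const 0).min_const M).dist_le_mul s t
  simp only [id, NNReal.coe_one, one_mul, Real.dist_eq] at h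
  rw [truncPos, truncPos, ← mul_sub, abs_mul, abs_two]
  exact mul_le_mul_of_nonneg_left h zero_le_two

lemma hasDerivAt_truncSq (M s : ℝ) : HasDerivAt (truncSq M) (truncPos M s) s :=
  ((continuous_truncPos M).integral_hasStrictDerivAt 0 s).hasDerivAt

lemma truncSq_eq {M s : ℝ} (hM : 0 ≤ M) (h : s ≤ M) : truncSq M s = (max s 0) ^ 2 := by
  have e : truncSq M s = ∫ x in (0 : ℝ)..s, 2 * max x 0 := by
    refine intervalIntegral.integral_congr fun x hx => truncPos_eq (max_le ?_ hM)
    exact hx.2.trans (max_le hM h)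
  rw [e, intervalIntegral.integral_eq_sub_of_hasDerivAt
    (fun x _ => hasDerivAt_max_zero_sq x)
    ((continuous_const.mul (continuous_id.max continuous_const)).intervalIntegrable _ _)]
  simp

lemma abs_truncSq_le {M : ℝ} (hM : 0 ≤ M) (s : ℝ) : |truncSq M s| ≤ 2 * M * |s| := by
  have := Convex.norm_image_sub_le_of_norm_hasDerivWithin_le (s := univ) (f := truncSq M)
    (fun x _ => (hasDerivAt_truncSq M x).hasDerivWithinAt) (fun x _ => abs_truncPos_le hM x)
    convex_univ (mem_univ 0) (mem_univ s)
  simpa [truncSq] using this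

lemma continuous_truncSq (M : ℝ) : Continuous (truncSq M) :=
  continuous_iff_continuousAt.2 fun s => (hasDerivAt_truncSq M s).continuousAt

/-- Homogeneous Gronwall inequality in integral form. -/
lemma eq_zero_of_le_integral {Y : ℝ → ℝ} {T B C : ℝ} (hC : 0 ≤ C)
    (h0 : ∀ t ∈ Ioo 0 T, 0 ≤ Y t) (hB : ∀ t ∈ Ioo 0 T, Y t ≤ B) (hi : IntegrableOn Y (Ioo 0 T))
    (h : ∀ t ∈ Ioo 0 T, Y t ≤ C * ∫ s in (0 : ℝ)..t, Y s) : ∀ t ∈ Ioo 0 T, Y t = 0 := by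
  have key : ∀ n : ℕ, ∀ t ∈ Ioo 0 T, Y t ≤ B * ((C * t) ^ n / n.factorial) := by
    intro n
    induction n with
    | zero => intro t ht; simpa using hB t ht
    | succ n ih =>
      intro t ht
      refine (h t ht).trans ?_
      have hsub : Ioc 0 t ⊆ Ioo 0 T := fun s hs => ⟨hs.1, hs.2.trans_lt ht.2⟩
      have h1 : ∫ s in (0 : ℝ)..t, Y s ≤ ∫ s in (0 : ℝ)..t, B * ((C * s) ^ n / n.factorial) := by
        rw [intervalIntegral.integral_of_le ht.1.le, intervalIntegral.integral_of_le ht.1.le]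
        refine setIntegral_mono_on (hi.mono_set hsub) ?_ measurableSet_Ioc
          fun s hs => ih s (hsub hs)
        exact (Continuous.integrableOn_Icc (by fun_prop)).mono_set Ioc_subset_Icc_self
      have h2 : ∫ s in (0 : ℝ)..t, B * ((C * s) ^ n / n.factorial) =
          B * C ^ n / n.factorial * (t ^ (n + 1) / (n + 1)) := by
        have : ∀ s : ℝ, B * ((C * s) ^ n / n.factorial) = B * C ^ n / n.factorial * s ^ n :=
          fun s => by rw [mul_pow]; ring
        simp only [this]
        rw [intervalIntegral.integral_const_mul, integral_pow]
        simp
      refine (mul_le_mul_of_nonneg_left (h1.trans_eq h2) hC).trans_eq ?_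
      rw [Nat.factorial_succ]
      push_cast
      field_simp
      ring
  intro t ht
  refine le_antisymm ?_ (h0 t ht)
  have hl := (FloorSemiring.tendsto_pow_div_factorial_atTop (C * t)).const_mul B
  rw [mul_zero] at hl
  exact ge_of_tendsto' hl fun n => key n t ht

/-! ### Bounded weak sub- and super-solutions -/

/-- Two vector fields on the cylinder that are weak gradients of almost all time slices of the
same function agree almost everywhere. -/
lemma MemLaW10.ae_eq_grad {Ω : Set (Sp N)} [IsFiniteMeasure (volume.restrict Ω)]
    (hΩ : IsOpen Ω) {T : ℝ} {a b : ENNReal} (ha : 1 ≤ a)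
    (hb : 1 ≤ b) {u : ℝ × Sp N → ℝ} {Du Du' : ℝ × Sp N → Sp N} (h : MemLaW10 Ω T a u Du)
    (h' : MemLaW10 Ω T b u Du') : ∀ᵐ z ∂(volume.restrict (Cyl Ω T)), Du z = Du' z := by
  have hm : AEMeasurable (fun z => ‖Du z - Du' z‖ₑ) (volume.restrict (Cyl Ω T)) :=
    (h.memLp_grad.1.sub h'.memLp_grad.1).enorm
  have hz : ∫⁻ z, ‖Du z - Du' z‖ₑ ∂(volume.restrict (Cyl Ω T)) = 0 := by
    rw [restrict_cyl] at hm ⊢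
    rw [lintegral_prod _ hm]
    rw [lintegral_eq_zero_iff' hm.lintegral_prod_right']
    filter_upwards [h.slice, h'.slice] with t ht ht'
    refine (lintegral_eq_zero_of_ae_eq_zero ?_)
    filter_upwards [ht.memW1.weakGrad.ae_eq hΩ ht'.memW1.weakGrad
      (ht.memW1.memLp_grad.integrable ha) (ht'.memW1.memLp_grad.integrable hb)] with x hx
    simp [hx]
  rw [lintegral_eq_zero_iff' hm] at hz
  filter_upwards [hz] with z hz
  simpa [sub_eq_zero] using hz

lemma MemLaW10.exists_grad_bound {Ω : Set (Sp N)} [IsFiniteMeasure (volume.restrict Ω)]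
    (hΩ : IsOpen Ω) {T : ℝ} {a : ENNReal} (ha : 1 ≤ a)
    {u : ℝ × Sp N → ℝ} {Du Du' : ℝ × Sp N → Sp N} (h : MemLaW10 Ω T a u Du)
    (h' : MemLaW10 Ω T ⊤ u Du') :
    ∃ K, ∀ᵐ z ∂(volume.restrict (Cyl Ω T)), ‖Du z‖ ≤ K := by
  refine ⟨lpNorm Du' ⊤ (volume.restrict (Cyl Ω T)), ?_⟩
  filter_upwards [ae_le_lpNorm_exponent_top h'.memLp_grad, h.ae_eq_grad hΩ ha le_top h']
    with z hz hz'
  rwa [hz']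

lemma MemLaW10.mono_exponent {Ω : Set (Sp N)} [IsFiniteMeasure (volume.restrict Ω)]
    {T : ℝ} {a b : ENNReal} (ha : 1 ≤ a) (hab : a ≤ b) (hb : b ≠ ⊤) {u : ℝ × Sp N → ℝ}
    {Du : ℝ × Sp N → Sp N} (h : MemLaW10 Ω T b u Du) : MemLaW10 Ω T a u Du := by
  have : IsFiniteMeasure ((volume : Measure (ℝ × Sp N)).restrict (Cyl Ω T)) := by
    rw [restrict_cyl]; infer_instance
  refine ⟨h.memLp.mono_exponent hab, h.memLp_grad.mono_exponent hab, ?_⟩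
  filter_upwards [h.slice] with t ht
  refine ⟨⟨ht.memW1.memLp.mono_exponent hab, ht.memW1.memLp_grad.mono_exponent hab,
    ht.memW1.weakGrad⟩, ?_⟩
  have hlim := ht.testLimit
  rw [if_neg hb] at hlim
  rw [if_neg (ne_top_of_le_ne_top hb hab)]
  exact hlim.mono_exponent hab ha ht.memW1.memLp.1 ht.memW1.memLp_grad.1

/-- A function that is essentially bounded on the cylinder and continuous up to the lateral
boundary and the initial time is bounded at every point. -/
lemma exists_bound_of_memLp_top {Ω : Set (Sp N)} (hΩ : IsOpen Ω) {T : ℝ} {u : ℝ × Sp N → ℝ}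
    (hc : ContinuousOn u (Ico 0 T ×ˢ closure Ω)) (h : MemLp u ⊤ (volume.restrict (Cyl Ω T))) :
    ∃ M, ∀ z ∈ Ico 0 T ×ˢ closure Ω, |u z| ≤ M := by
  obtain ⟨M, hM⟩ : ∃ M, ∀ᵐ z ∂(volume.restrict (Cyl Ω T)), ‖u z‖ ≤ M :=
    ⟨_, ae_le_lpNorm_exponent_top h⟩
  refine ⟨M, ?_⟩
  have hsub : Cyl Ω T ⊆ Ico 0 T ×ˢ closure Ω := prod_mono Ioo_subset_Ico_self subset_closure
  have hmin : ContinuousOn (fun z => min |u z| M) (Ico 0 T ×ˢ closure Ω) :=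
    hc.abs.inf continuousOn_const
  have h1 : EqOn (fun z => |u z|) (fun z => min |u z| M) (Cyl Ω T) := by
    refine Measure.eqOn_open_of_ae_eq (μ := volume) ?_ (isOpen_Ioo.prod hΩ) (hc.abs.mono hsub)
      (hmin.mono hsub)
    filter_upwards [hM] with z hz
    exact (min_eq_left hz).symm
  have h2 := h1.of_subset_closure hc.abs hmin hsub (by
    intro z hz
    have hT : 0 < T := hz.1.1.trans_lt hz.1.2
    rw [Cyl, closure_prod_eq, closure_Ioo hT.ne]
    exact ⟨Ico_subset_Icc_self hz.1, hz.2⟩)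
  intro z hz
  exact min_eq_left_iff.1 (h2 hz).symm

/-- What the comparison argument uses of a bounded sub- or super-solution `u` with gradient `Du`
and time derivative `ut`, apart from the differential inequality: values in `[0, M]`, gradients
bounded by `K`. -/
structure IsBoundedCandidate (p : ℝ) (Ω : Set (Sp N)) (T M K : ℝ) (u ut : ℝ × Sp N → ℝ)
    (Du : ℝ × Sp N → Sp N) : Prop where
  nonneg : ∀ z ∈ Ico 0 T ×ˢ closure Ω, 0 ≤ u z
  le : ∀ z ∈ Ico 0 T ×ˢ closure Ω, u z ≤ M
  continuousOn : ContinuousOn u (Ico 0 T ×ˢ closure Ω)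
  memLaW10 : MemLaW10 Ω T (ENNReal.ofReal p) u Du
  norm_grad_le : ∀ᵐ z ∂(volume.restrict (Cyl Ω T)), ‖Du z‖ ≤ K
  timeDeriv : HasWeakTimeDeriv Ω T u ut
  integrable_timeDeriv : IntegrableOn ut (Cyl Ω T)

lemma IsWeak.exists_isBoundedCandidate {R : ℝ → ℝ → Prop} {P : Params} {Ω : Set (Sp N)}
    [IsFiniteMeasure (volume.restrict Ω)] (hΩ : IsOpen Ω) {T : ℝ} (hp : 2 ≤ P.p)
    {u₀ : Sp N → ℝ} {u : ℝ × Sp N → ℝ} (h : IsWeak R P Ω T u₀ u)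
    (h' : ∃ Du : ℝ × Sp N → Sp N, MemLaW10 Ω T ⊤ u Du) :
    ∃ (M₀ K₀ : ℝ) (Du : ℝ × Sp N → Sp N) (ut : ℝ × Sp N → ℝ),
      (∀ M K, M₀ ≤ M → K₀ ≤ K → IsBoundedCandidate P.p Ω T M K u ut Du) ∧
      ∀ (φ : ℝ × Sp N → ℝ) (Dφ : ℝ × Sp N → Sp N), IsAdmissible P.p Ω T φ Dφ →
        R (∫ z in Cyl Ω T, (ut z * φ z + ‖Du z‖ ^ (P.p - 2) * inner ℝ (Du z) (Dφ z)))
          (∫ z in Cyl Ω T, rhs P Ω u Du z * φ z) := by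
  have : IsFiniteMeasure ((volume : Measure (ℝ × Sp N)).restrict (Cyl Ω T)) := by
    rw [restrict_cyl]; infer_instance
  obtain ⟨Du', hDu'⟩ := h'
  obtain ⟨Du, ut, hDu, htd, hut, hweak⟩ := h.weak
  have hple : P.p ≤ P.topExp := le_max_left _ _
  have h1p : (1 : ENNReal) ≤ ENNReal.ofReal P.p := by
    rw [← ENNReal.ofReal_one]; exact ENNReal.ofReal_le_ofReal (by linarith)
  have hpt := ENNReal.ofReal_le_ofReal hple
  obtain ⟨K₀, hK₀⟩ := hDu.exists_grad_bound hΩ (h1p.trans hpt) hDu'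
  obtain ⟨M₀, hM₀⟩ := exists_bound_of_memLp_top hΩ h.continuousOn hDu'.memLp
  refine ⟨M₀, K₀, Du, ut, fun M K hM hK => ⟨h.nonneg, fun z hz => ?_, h.continuousOn,
    hDu.mono_exponent h1p hpt ENNReal.ofReal_ne_top, ?_, htd, ?_⟩, hweak⟩
  · exact ((le_abs_self _).trans (hM₀ z hz)).trans hM
  · filter_upwards [hK₀] with z hz using hz.trans hK
  · exact hut.integrable one_le_two

/-! ### The test functions -/

lemma isFiniteMeasure_cyl (Ω : Set (Sp N)) [IsFiniteMeasure (volume.restrict Ω)] (T : ℝ) :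
    IsFiniteMeasure ((volume : Measure (ℝ × Sp N)).restrict (Cyl Ω T)) := by
  rw [restrict_cyl]; infer_instance

lemma cyl_subset (Ω : Set (Sp N)) (T : ℝ) : Cyl Ω T ⊆ Ico 0 T ×ˢ closure Ω :=
  prod_mono Ioo_subset_Ico_self subset_closure

lemma IsBoundedCandidate.sub_le {p T M K M' K' : ℝ} {Ω : Set (Sp N)} {u v ut vt : ℝ × Sp N → ℝ}
    {Du Dv : ℝ × Sp N → Sp N} (hu : IsBoundedCandidate p Ω T M K u ut Du)
    (hv : IsBoundedCandidate p Ω T M' K' v vt Dv) {z : ℝ × Sp N}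
    (hz : z ∈ Ico 0 T ×ˢ closure Ω) : u z - v z ≤ M := by
  linarith [hu.le z hz, hv.nonneg z hz]

/-- The square of the positive part of `u - v`, cut off in time before the final time, is an
admissible test function. -/
lemma IsBoundedCandidate.isAdmissible {p T M K : ℝ} {Ω : Set (Sp N)}
    [IsFiniteMeasure (volume.restrict Ω)] {u v ut vt : ℝ × Sp N → ℝ}
    {Du Dv : ℝ × Sp N → Sp N} (hp : 1 ≤ p) (hM : 0 ≤ M)
    (hu : IsBoundedCandidate p Ω T M K u ut Du) (hv : IsBoundedCandidate p Ω T M K v vt Dv)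
    {χ : ℝ → ℝ} (hχ : Continuous χ) (h0 : ∀ t, 0 ≤ χ t) (h1 : ∀ t, χ t ≤ 1) {τ : ℝ} (hτ : τ < T)
    (hχτ : ∀ t, τ ≤ t → χ t = 0) :
    IsAdmissible p Ω T (fun z => χ z.1 * truncSq M (u z - v z))
      (fun z => (χ z.1 * truncPos M (u z - v z)) • (Du z - Dv z)) := by
  have h1p : (1 : ENNReal) ≤ ENNReal.ofReal p := by
    rw [← ENNReal.ofReal_one]; exact ENNReal.ofReal_le_ofReal hp
  have hL := hu.memLaW10.memLp.sub hv.memLaW10.memLp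
  have hLg := hu.memLaW10.memLp_grad.sub hv.memLaW10.memLp_grad
  have hχm : AEStronglyMeasurable (fun z : ℝ × Sp N => χ z.1) (volume.restrict (Cyl Ω T)) :=
    (hχ.comp continuous_fst).aestronglyMeasurable
  refine ⟨fun z hz => ?_, fun z hz => ?_, ?_, ?_, ?_⟩
  · rcases lt_or_ge z.1 T with ht | ht
    · rw [truncSq_eq hM (hu.sub_le hv ⟨⟨hz.1.1, ht⟩, hz.2⟩)]
      exact mul_nonneg (h0 _) (sq_nonneg _)
    · rw [hχτ _ (hτ.le.trans ht), zero_mul]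
  · rcases lt_or_ge z.1 T with ht | ht
    · have hc : ContinuousOn (fun z => χ z.1 * truncSq M (u z - v z)) (Ico 0 T ×ˢ closure Ω) :=
        (hχ.comp continuous_fst).continuousOn.mul
          ((continuous_truncSq M).comp_continuousOn (hu.continuousOn.sub hv.continuousOn))
      refine (hc z ⟨⟨hz.1.1, ht⟩, hz.2⟩).mono_of_mem_nhdsWithin ?_
      have : {y : ℝ × Sp N | y.1 < T} ∈ 𝓝 z :=
        (isOpen_Iio.preimage continuous_fst).mem_nhds ht
      filter_upwards [self_mem_nhdsWithin, mem_nhdsWithin_of_mem_nhds this] with y hy hyT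
      exact ⟨⟨hy.1.1, hyT⟩, hy.2⟩
    · have : {y : ℝ × Sp N | τ < y.1} ∈ 𝓝 z :=
        (isOpen_Ioi.preimage continuous_fst).mem_nhds (hτ.trans_le ht)
      refine ContinuousAt.continuousWithinAt ?_
      refine (continuousAt_const (y := (0 : ℝ))).congr ?_
      filter_upwards [this] with y hy
      rw [hχτ _ (le_of_lt hy), zero_mul]
  · refine hL.of_le_mul (c := 2 * M)
      (hχm.mul ((continuous_truncSq M).comp_aestronglyMeasurable hL.1))
      (Eventually.of_forall fun z => ?_)
    rw [norm_mul, Real.norm_eq_abs, abs_of_nonneg (h0 _)]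
    exact (mul_le_of_le_one_left (norm_nonneg _) (h1 _)).trans (abs_truncSq_le hM _)
  · refine hLg.of_le_mul (c := 2 * M)
      ((hχm.mul ((continuous_truncPos M).comp_aestronglyMeasurable hL.1)).smul hLg.1)
      (Eventually.of_forall fun z => ?_)
    rw [norm_smul, norm_mul, Real.norm_eq_abs, abs_of_nonneg (h0 _)]
    refine mul_le_mul_of_nonneg_right ?_ (norm_nonneg _)
    exact (mul_le_of_le_one_left (norm_nonneg _) (h1 _)).trans (abs_truncPos_le hM _)
  · have hKu := hu.norm_grad_le
    have hKv := hv.norm_grad_le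
    rw [restrict_cyl] at hKu hKv
    filter_upwards [hu.memLaW10.slice, hv.memLaW10.slice, Measure.ae_ae_of_ae_prod hKu,
      Measure.ae_ae_of_ae_prod hKv] with t hut hvt hKu hKv
    have hlu := hut.testLimit
    have hlv := hvt.testLimit
    rw [if_neg ENNReal.ofReal_ne_top] at hlu hlv
    have hK : ∀ᵐ x ∂(volume.restrict Ω), ‖Du (t, x) - Dv (t, x)‖ ≤ K + K := by
      filter_upwards [hKu, hKv] with x hx hx' using (norm_sub_le _ _).trans (add_le_add hx hx')
    have hχt : |χ t| ≤ 1 := by rw [abs_of_nonneg (h0 t)]; exact h1 t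
    refine MemW10.comp_of_testLimit (g := fun s => χ t * truncSq M s)
      (k := fun s => χ t * truncPos M s) (L := max (2 * M) 2) h1p ENNReal.ofReal_ne_top
      (hut.memW1.memLp.sub hvt.memW1.memLp) (hut.memW1.memLp_grad.sub hvt.memW1.memLp_grad)
      (hlu.sub h1p hut.memW1.memLp hvt.memW1.memLp hut.memW1.memLp_grad hvt.memW1.memLp_grad hlv)
      hK (fun s => (hasDerivAt_truncSq M s).const_mul _) (by simp [truncSq]) (fun s => ?_)
      (continuous_const.mul (continuous_truncPos M)) (fun s s' => ?_)
    · rw [abs_mul]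
      exact (mul_le_of_le_one_left (abs_nonneg _) hχt).trans
        ((abs_truncPos_le hM s).trans (le_max_left _ _))
    · rw [← mul_sub, abs_mul]
      refine (mul_le_of_le_one_left (abs_nonneg _) hχt).trans
        ((abs_truncPos_sub_le M s s').trans ?_)
      exact mul_le_mul_of_nonneg_right (le_max_right _ _) (abs_nonneg _)

/-! ### Integrability of the terms of the equation -/

lemma aestronglyMeasurable_integral_slice {Ω : Set (Sp N)} {T : ℝ}
    [IsFiniteMeasure (volume.restrict Ω)] {f : ℝ × Sp N → ℝ}
    (hf : AEStronglyMeasurable f (volume.restrict (Cyl Ω T))) :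
    AEStronglyMeasurable (fun t => ∫ y in Ω, f (t, y)) (volume.restrict (Ioo 0 T)) := by
  rw [restrict_cyl] at hf
  exact hf.integral_prod_right'

lemma aestronglyMeasurable_comp_fst {Ω : Set (Sp N)} {T : ℝ}
    [IsFiniteMeasure (volume.restrict Ω)] {f : ℝ → ℝ}
    (hf : AEStronglyMeasurable f (volume.restrict (Ioo 0 T))) :
    AEStronglyMeasurable (fun z : ℝ × Sp N => f z.1) (volume.restrict (Cyl Ω T)) := by
  rw [restrict_cyl]
  exact hf.comp_fst

lemma Params.exists_reaction_bound (P : Params) (hl : 0 < P.l) (hσ : 0 < P.σ)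
    (hq : 0 ≤ P.q) (hr : 0 ≤ P.r) (hk : 0 < P.k) (hm : 0 ≤ P.m) (M K B : ℝ) :
    ∃ C, ∀ x a J : ℝ, 0 ≤ x → x ≤ M → 0 ≤ a → a ≤ K → 0 ≤ J → J ≤ B →
      |P.reaction x a J| ≤ C := by
  have hc : Continuous fun y : ℝ × ℝ × ℝ => P.α * y.1 ^ P.k * y.2.2
      - P.β * y.1 ^ P.l * y.2.1 ^ P.q + P.γ * y.1 ^ P.m + P.μ * y.2.1 ^ P.r
      - P.ν * y.1 ^ P.σ := by
    have h1 : ∀ e : ℝ, 0 ≤ e → Continuous fun y : ℝ × ℝ × ℝ => y.1 ^ e := fun e he =>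
      (Real.continuous_rpow_const he).comp continuous_fst
    have h2 : ∀ e : ℝ, 0 ≤ e → Continuous fun y : ℝ × ℝ × ℝ => y.2.1 ^ e := fun e he =>
      (Real.continuous_rpow_const he).comp (continuous_fst.comp continuous_snd)
    have := h1 _ hk.le
    have := h1 _ hl.le
    have := h1 _ hm
    have := h1 _ hσ.le
    have := h2 _ hq
    have := h2 _ hr
    fun_prop
  obtain ⟨C, hC⟩ :=
    (isCompact_Icc.prod (isCompact_Icc.prod isCompact_Icc)).exists_bound_of_continuousOn
      (s := Icc 0 M ×ˢ Icc 0 K ×ˢ Icc 0 B) hc.continuousOn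
  refine ⟨C, fun x a J hx hxM ha haK hJ hJB => ?_⟩
  have := hC (x, a, J) ⟨⟨hx, hxM⟩, ⟨ha, haK⟩, ⟨hJ, hJB⟩⟩
  rw [Params.reaction, abs_rpow_mul_self_eq hk hx, abs_rpow_mul_self_eq hl hx,
    abs_rpow_mul_self_eq hσ hx]
  exact this

lemma IsBoundedCandidate.integrable_slice {p T M K : ℝ} {Ω : Set (Sp N)} (hΩ : IsOpen Ω)
    [IsFiniteMeasure (volume.restrict Ω)] {u ut : ℝ × Sp N → ℝ} {Du : ℝ × Sp N → Sp N}
    (hu : IsBoundedCandidate p Ω T M K u ut Du) {s : ℝ} (hs : 0 ≤ s) {t : ℝ} (ht : t ∈ Ico 0 T) :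
    IntegrableOn (fun y => |u (t, y)| ^ s) Ω := by
  have hc : ContinuousOn (fun y => |u (t, y)| ^ s) Ω := by
    refine (Real.continuous_rpow_const hs).comp_continuousOn (ContinuousOn.abs ?_)
    exact hu.continuousOn.comp (by fun_prop) fun y hy => ⟨ht, subset_closure hy⟩
  refine Integrable.of_bound (hc.aestronglyMeasurable hΩ.measurableSet) (M ^ s) ?_
  refine (ae_restrict_iff' hΩ.measurableSet).2 (Eventually.of_forall fun y hy => ?_)
  have hy' : (t, y) ∈ Ico 0 T ×ˢ closure Ω := ⟨ht, subset_closure hy⟩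
  rw [Real.norm_eq_abs, abs_of_nonneg (by positivity), abs_of_nonneg (hu.nonneg _ hy')]
  exact Real.rpow_le_rpow (hu.nonneg _ hy') (hu.le _ hy') hs

lemma IsBoundedCandidate.integral_slice_le {p T M K : ℝ} {Ω : Set (Sp N)} (hΩ : IsOpen Ω)
    [IsFiniteMeasure (volume.restrict Ω)] {u ut : ℝ × Sp N → ℝ} {Du : ℝ × Sp N → Sp N}
    (hu : IsBoundedCandidate p Ω T M K u ut Du) {s : ℝ} (hs : 0 ≤ s) {t : ℝ} (ht : t ∈ Ico 0 T) :
    ∫ y in Ω, |u (t, y)| ^ s ≤ volume.real Ω * M ^ s := by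
  have h : ∫ y in Ω, |u (t, y)| ^ s ≤ ∫ y in Ω, M ^ s := by
    refine setIntegral_mono_on (hu.integrable_slice hΩ hs ht) (integrable_const _)
      hΩ.measurableSet fun y hy => ?_
    have hy' : (t, y) ∈ Ico 0 T ×ˢ closure Ω := ⟨ht, subset_closure hy⟩
    rw [abs_of_nonneg (hu.nonneg _ hy')]
    exact Real.rpow_le_rpow (hu.nonneg _ hy') (hu.le _ hy') hs
  simpa using h

lemma IsBoundedCandidate.integrable_terms {P : Params} (hl : 0 < P.l) (hσ : 0 < P.σ)
    (hp : 2 ≤ P.p) (hq : 0 ≤ P.q) (hr : 0 ≤ P.r) (hk : 0 < P.k) (hm : 0 ≤ P.m) (hs : 0 ≤ P.s)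
    {T M K : ℝ} {Ω : Set (Sp N)} (hΩ : IsOpen Ω)
    [IsFiniteMeasure (volume.restrict Ω)] {u ut : ℝ × Sp N → ℝ} {Du : ℝ × Sp N → Sp N}
    (hu : IsBoundedCandidate P.p Ω T M K u ut Du)
    {g k : ℝ × Sp N → ℝ} {V : ℝ × Sp N → Sp N} {C : ℝ}
    (hg : AEStronglyMeasurable g (volume.restrict (Cyl Ω T)))
    (hkm : AEStronglyMeasurable k (volume.restrict (Cyl Ω T)))
    (hV : AEStronglyMeasurable V (volume.restrict (Cyl Ω T)))
    (hgC : ∀ z ∈ Cyl Ω T, |g z| ≤ C) (hkC : ∀ z ∈ Cyl Ω T, |k z| ≤ C)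
    (hVC : ∀ᵐ z ∂(volume.restrict (Cyl Ω T)), ‖V z‖ ≤ C) :
    IntegrableOn (fun z => ut z * g z) (Cyl Ω T) ∧
    IntegrableOn (fun z => ‖Du z‖ ^ (P.p - 2) * inner ℝ (Du z) (V z) * k z) (Cyl Ω T) ∧
    IntegrableOn (fun z => rhs P Ω u Du z * g z) (Cyl Ω T) := by
  have := isFiniteMeasure_cyl Ω T
  have hcm : MeasurableSet (Cyl Ω T) := (isOpen_Ioo.prod hΩ).measurableSet
  have hgC' : ∀ᵐ z ∂(volume.restrict (Cyl Ω T)), ‖g z‖ ≤ C :=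
    (ae_restrict_iff' hcm).2 (Eventually.of_forall hgC)
  have hkC' : ∀ᵐ z ∂(volume.restrict (Cyl Ω T)), ‖k z‖ ≤ C :=
    (ae_restrict_iff' hcm).2 (Eventually.of_forall hkC)
  have hmem : ∀ᵐ z ∂(volume.restrict (Cyl Ω T)), z ∈ Cyl Ω T := ae_restrict_mem hcm
  have hum := hu.memLaW10.memLp.1
  have hDm := hu.memLaW10.memLp_grad.1
  refine ⟨hu.integrable_timeDeriv.mul_bdd hg hgC', ?_, ?_⟩
  · refine Integrable.of_bound ((((Real.continuous_rpow_const
      (by linarith : 0 ≤ P.p - 2)).comp_aestronglyMeasurable hDm.norm).mul (hDm.inner hV)).mul hkm)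
      (K ^ (P.p - 2) * (K * C) * C) ?_
    filter_upwards [hVC, hkC', hu.norm_grad_le] with z h1 h2 h3
    have hK : 0 ≤ K := (norm_nonneg _).trans h3
    have hC : 0 ≤ C := (norm_nonneg _).trans h1
    rw [norm_mul, norm_mul, Real.norm_eq_abs (‖Du z‖ ^ _), abs_of_nonneg (by positivity)]
    have h4 := Real.rpow_le_rpow (norm_nonneg _) h3 (by linarith : 0 ≤ P.p - 2)
    have h5 : ‖inner ℝ (Du z) (V z)‖ ≤ K * C :=
      (norm_inner_le_norm _ _).trans (mul_le_mul h3 h1 (norm_nonneg _) hK)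
    gcongr
  · obtain ⟨Cr, hCr⟩ := P.exists_reaction_bound hl hσ hq hr hk hm M K (volume.real Ω * M ^ P.s)
    have hJ : AEStronglyMeasurable (fun z : ℝ × Sp N => ∫ y in Ω, |u (z.1, y)| ^ P.s)
        (volume.restrict (Cyl Ω T)) :=
      aestronglyMeasurable_comp_fst (aestronglyMeasurable_integral_slice
        ((Real.continuous_rpow_const hs).comp_aestronglyMeasurable
          (continuous_abs.comp_aestronglyMeasurable hum)))
    have hpow : ∀ e : ℝ, AEMeasurable (fun z => |u z| ^ e) (volume.restrict (Cyl Ω T)) := fun e =>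
      (continuous_abs.comp_aestronglyMeasurable hum).aemeasurable.pow_const e
    have hDpow : ∀ e : ℝ, AEMeasurable (fun z => ‖Du z‖ ^ e) (volume.restrict (Cyl Ω T)) :=
      fun e => hDm.norm.aemeasurable.pow_const e
    have hua := hum.aemeasurable
    have hrm : AEStronglyMeasurable (rhs P Ω u Du) (volume.restrict (Cyl Ω T)) := by
      refine AEMeasurable.aestronglyMeasurable ?_
      exact (((((((hpow _).mul hua).const_mul _).mul hJ.aemeasurable).sub
        ((((hpow _).mul hua).const_mul _).mul (hDpow _))).add
        ((hua.pow_const _).const_mul _)).add ((hDpow _).const_mul _)).sub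
        (((hpow _).mul hua).const_mul _)
    refine Integrable.of_bound (hrm.mul hg) (Cr * C) ?_
    filter_upwards [hmem, hu.norm_grad_le] with z hz hKz
    have hz' := cyl_subset Ω T hz
    have h1 : |rhs P Ω u Du z| ≤ Cr := hCr _ _ _ (hu.nonneg z hz') (hu.le z hz') (norm_nonneg _)
      hKz (integral_nonneg fun y => by positivity) (hu.integral_slice_le hΩ hs hz'.1)
    rw [norm_mul]
    exact mul_le_mul h1 (hgC z hz) (norm_nonneg _) ((abs_nonneg _).trans h1)

/-! ### The integrated comparison inequality -/

/-- The integrand of the weak formulation, left-hand side minus right-hand side, for a test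
function with value `g` and gradient `k V`. -/
noncomputable def testResidual (P : Params) (Ω : Set (Sp N)) (u ut : ℝ × Sp N → ℝ)
    (Du : ℝ × Sp N → Sp N) (g k : ℝ × Sp N → ℝ) (V : ℝ × Sp N → Sp N) (z : ℝ × Sp N) : ℝ :=
  ut z * g z + ‖Du z‖ ^ (P.p - 2) * inner ℝ (Du z) (V z) * k z - rhs P Ω u Du z * g z

lemma IsBoundedCandidate.sub_eq_integral_testResidual {P : Params} (hl : 0 < P.l) (hσ : 0 < P.σ)
    (hp : 2 ≤ P.p) (hq : 0 ≤ P.q) (hr : 0 ≤ P.r) (hk : 0 < P.k) (hm : 0 ≤ P.m) (hs : 0 ≤ P.s)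
    {T M K : ℝ} {Ω : Set (Sp N)} (hΩ : IsOpen Ω)
    [IsFiniteMeasure (volume.restrict Ω)] {u ut : ℝ × Sp N → ℝ} {Du : ℝ × Sp N → Sp N}
    (hu : IsBoundedCandidate P.p Ω T M K u ut Du)
    {g k : ℝ × Sp N → ℝ} {V : ℝ × Sp N → Sp N} {C : ℝ}
    (hg : AEStronglyMeasurable g (volume.restrict (Cyl Ω T)))
    (hkm : AEStronglyMeasurable k (volume.restrict (Cyl Ω T)))
    (hV : AEStronglyMeasurable V (volume.restrict (Cyl Ω T)))
    (hgC : ∀ z ∈ Cyl Ω T, |g z| ≤ C) (hkC : ∀ z ∈ Cyl Ω T, |k z| ≤ C)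
    (hVC : ∀ᵐ z ∂(volume.restrict (Cyl Ω T)), ‖V z‖ ≤ C)
    {χ : ℝ → ℝ} (hχ : Continuous χ) (h1 : ∀ t, |χ t| ≤ 1) :
    (∫ z in Cyl Ω T, (ut z * (χ z.1 * g z) +
        ‖Du z‖ ^ (P.p - 2) * inner ℝ (Du z) ((χ z.1 * k z) • V z))) -
      ∫ z in Cyl Ω T, rhs P Ω u Du z * (χ z.1 * g z) =
    ∫ z in Cyl Ω T, χ z.1 * testResidual P Ω u ut Du g k V z := by
  have hχm : AEStronglyMeasurable (fun z : ℝ × Sp N => χ z.1) (volume.restrict (Cyl Ω T)) :=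
    (hχ.comp continuous_fst).aestronglyMeasurable
  have hb : ∀ {f : ℝ × Sp N → ℝ}, (∀ z ∈ Cyl Ω T, |f z| ≤ C) →
      ∀ z ∈ Cyl Ω T, |χ z.1 * f z| ≤ C := fun hf z hz => by
    rw [abs_mul]
    exact (mul_le_of_le_one_left (abs_nonneg _) (h1 _)).trans (hf z hz)
  obtain ⟨i1, i2, i3⟩ := hu.integrable_terms hl hσ hp hq hr hk hm hs hΩ (hχm.mul hg) (hχm.mul hkm)
    hV (hb hgC) (hb hkC) hVC
  have e : ∀ z, ‖Du z‖ ^ (P.p - 2) * inner ℝ (Du z) ((χ z.1 * k z) • V z) =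
      ‖Du z‖ ^ (P.p - 2) * inner ℝ (Du z) (V z) * (χ z.1 * k z) := fun z => by
    rw [real_inner_smul_right]; ring
  simp only [e]
  refine (integral_sub (i1.add i2) i3).symm.trans ?_
  congr 1; ext z
  simp only [testResidual, Pi.add_apply, Pi.mul_apply]
  ring

/-- Continuous cutoffs in time can be replaced by the indicator function of `(0, τ]`. -/
lemma setIntegral_nonpos_of_cutoff {T τ : ℝ} (hτ : τ ∈ Ioo 0 T) {Ω : Set (Sp N)}
    {H : ℝ × Sp N → ℝ} (hH : IntegrableOn H (Cyl Ω T))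
    (h : ∀ (χ : ℝ → ℝ) (τ' : ℝ), Continuous χ → (∀ t, 0 ≤ χ t) → (∀ t, χ t ≤ 1) → τ' < T →
      (∀ t, τ' ≤ t → χ t = 0) → ∫ z in Cyl Ω T, χ z.1 * H z ≤ 0) :
    ∫ z in Ioc 0 τ ×ˢ Ω, H z ≤ 0 := by
  set δ : ℕ → ℝ := fun n => (T - τ) / (n + 2) with hδ
  have hTτ : 0 < T - τ := by linarith [hτ.2]
  have hδ0 : ∀ n, 0 < δ n := fun n => by positivity
  have hδT : ∀ n, τ + δ n < T := fun n => by
    have : δ n < T - τ := div_lt_self hTτ (by linarith [Nat.cast_nonneg (α := ℝ) n])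
    linarith
  have hδl : Tendsto δ atTop (𝓝 0) :=
    tendsto_const_nhds.div_atTop (tendsto_atTop_add_const_right _ _ tendsto_natCast_atTop_atTop)
  have hs01 : ∀ n t, 0 ≤ smoothStep (δ n) τ t ∧ smoothStep (δ n) τ t ≤ 1 := fun n t =>
    ⟨Real.smoothTransition.nonneg _, Real.smoothTransition.le_one _⟩
  have hle : ∀ n, ∫ z in Cyl Ω T, (1 - smoothStep (δ n) τ z.1) * H z ≤ 0 := fun n =>
    h (fun t => 1 - smoothStep (δ n) τ t) (τ + δ n)
      (continuous_const.sub (contDiff_smoothStep _ _).continuous)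
      (fun t => by linarith [(hs01 n t).2]) (fun t => by linarith [(hs01 n t).1]) (hδT n)
      (fun t ht => by rw [smoothStep_of_ge (hδ0 n) ht, sub_self])
  have hset : Cyl Ω T ∩ {z | z.1 ≤ τ} = Ioc 0 τ ×ˢ Ω := by
    ext z
    exact ⟨fun hz => ⟨⟨hz.1.1.1, hz.2⟩, hz.1.2⟩,
      fun hz => ⟨⟨⟨hz.1.1, hz.1.2.trans_lt hτ.2⟩, hz.2⟩, hz.1.2⟩⟩
  have hms : MeasurableSet {z : ℝ × Sp N | z.1 ≤ τ} := measurableSet_Iic.preimage measurable_fst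
  have hlim : Tendsto (fun n => ∫ z in Cyl Ω T, (1 - smoothStep (δ n) τ z.1) * H z) atTop
      (𝓝 (∫ z in Cyl Ω T, {z : ℝ × Sp N | z.1 ≤ τ}.indicator H z)) := by
    refine tendsto_integral_of_dominated_convergence (fun z => ‖H z‖) (fun n => ?_) hH.norm
      (fun n => Eventually.of_forall fun z => ?_) (Eventually.of_forall fun z => ?_)
    · exact ((continuous_const.sub (contDiff_smoothStep _ _).continuous).comp
        continuous_fst).aestronglyMeasurable.mul hH.1
    · rw [norm_mul]
      refine mul_le_of_le_one_left (norm_nonneg _) ?_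
      rw [Real.norm_eq_abs, abs_le]
      constructor <;> linarith [(hs01 n z.1).1, (hs01 n z.1).2]
    · by_cases hz : z.1 ≤ τ
      · rw [indicator_of_mem (show z ∈ {z : ℝ × Sp N | z.1 ≤ τ} from hz)]
        refine tendsto_const_nhds.congr fun n => ?_
        rw [smoothStep_of_le (hδ0 n) hz, sub_zero, one_mul]
      · rw [indicator_of_notMem (show z ∉ {z : ℝ × Sp N | z.1 ≤ τ} from hz)]
        refine tendsto_const_nhds.congr' ?_
        filter_upwards [hδl.eventually_lt_const (sub_pos.2 (not_le.1 hz))] with n hn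
        rw [smoothStep_of_ge (hδ0 n) (by linarith), sub_self, zero_mul]
  rw [setIntegral_indicator hms, hset] at hlim
  exact le_of_tendsto' hlim hle

/-- Energy identity: testing `∂ₜ(u - v)` with the square of the positive part of `u - v`. -/
lemma IsBoundedCandidate.integral_timeDeriv_mul {p T M K : ℝ} (hT : 0 < T) (hM : 0 ≤ M)
    {Ω : Set (Sp N)} (hΩ : IsOpen Ω)
    [IsFiniteMeasure (volume.restrict Ω)] {u v ut vt : ℝ × Sp N → ℝ} {Du Dv : ℝ × Sp N → Sp N}
    (hu : IsBoundedCandidate p Ω T M K u ut Du) (hv : IsBoundedCandidate p Ω T M K v vt Dv)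
    (h0 : ∀ᵐ x ∂(volume.restrict Ω), u (0, x) ≤ v (0, x)) {τ : ℝ} (hτ : τ ∈ Ioo 0 T) :
    ∫ z in Ioc 0 τ ×ˢ Ω, (ut z - vt z) * truncSq M (u z - v z) =
      3⁻¹ * ∫ x in Ω, (max (u (τ, x) - v (τ, x)) 0) ^ 3 := by
  have := isFiniteMeasure_cyl Ω T
  have hcm : MeasurableSet (Cyl Ω T) := (isOpen_Ioo.prod hΩ).measurableSet
  have hbd : ∀ {f ft : ℝ × Sp N → ℝ} {Df : ℝ × Sp N → Sp N},
      IsBoundedCandidate p Ω T M K f ft Df → ∀ z ∈ Ico 0 T ×ˢ closure Ω, |f z| ≤ M :=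
    fun hf z hz => by rw [abs_of_nonneg (hf.nonneg z hz)]; exact hf.le z hz
  have hint : ∀ {f ft : ℝ × Sp N → ℝ} {Df : ℝ × Sp N → Sp N},
      IsBoundedCandidate p Ω T M K f ft Df → IntegrableOn f (Cyl Ω T) := fun hf =>
    Integrable.of_bound hf.memLaW10.memLp.1 M ((ae_restrict_iff' hcm).2
      (Eventually.of_forall fun z hz => hbd hf z (cyl_subset Ω T hz)))
  have hsub : Ioc 0 τ ×ˢ Ω ⊆ Cyl Ω T := prod_mono (fun t ht => ⟨ht.1, ht.2.trans_lt hτ.2⟩) le_rfl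
  have hI : IntegrableOn (fun z => (ut z - vt z) * truncSq M (u z - v z)) (Ioc 0 τ ×ˢ Ω) := by
    refine IntegrableOn.mono_set ?_ hsub
    refine (hu.integrable_timeDeriv.sub hv.integrable_timeDeriv).mul_bdd (c := 2 * M * (M + M))
      ((continuous_truncSq M).comp_aestronglyMeasurable
        (hu.memLaW10.memLp.1.sub hv.memLaW10.memLp.1)) ?_
    refine (ae_restrict_iff' hcm).2 (Eventually.of_forall fun z hz => ?_)
    refine (abs_truncSq_le hM _).trans (mul_le_mul_of_nonneg_left ?_ (by positivity))
    have hz' := cyl_subset Ω T hz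
    exact (abs_sub _ _).trans (add_le_add (hbd hu z hz') (hbd hv z hz'))
  have hrestr : (volume : Measure (ℝ × Sp N)).restrict (Ioc 0 τ ×ˢ Ω) =
      (volume.restrict (Ioc 0 τ)).prod (volume.restrict Ω) := by
    rw [Measure.prod_restrict]; rfl
  rw [IntegrableOn, hrestr] at hI
  rw [hrestr, integral_prod_symm _ hI, ← integral_const_mul]
  refine integral_congr_ae ?_
  filter_upwards [h0, ae_restrict_mem hΩ.measurableSet,
    hu.timeDeriv.ae_eq_add_integral hΩ hT (hint hu) hu.integrable_timeDeriv hu.continuousOn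
      (hbd hu),
    hv.timeDeriv.ae_eq_add_integral hΩ hT (hint hv) hv.integrable_timeDeriv hv.continuousOn
      (hbd hv)] with x hx0 hxΩ hxu hxv
  have hiv : ∀ {f : ℝ → ℝ}, IntegrableOn f (Ioo 0 T) → ∀ t ∈ Ico 0 T,
      IntervalIntegrable f volume 0 t := fun hf t ht => by
    rw [intervalIntegrable_iff_integrableOn_Ioc_of_le ht.1]
    exact hf.mono_set fun s hs => ⟨hs.1, hs.2.trans_lt ht.2⟩
  set c : ℝ := u (0, x) - v (0, x) with hc
  have hprim : ∀ t ∈ Ico 0 T, c + ∫ s in (0 : ℝ)..t, (ut (s, x) - vt (s, x)) =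
      u (t, x) - v (t, x) := fun t ht => by
    rw [intervalIntegral.integral_sub (hiv hxu.1 t ht) (hiv hxv.1 t ht), hxu.2 t ht, hxv.2 t ht]
    ring
  have hIcc : ∀ t ∈ Icc 0 τ, t ∈ Ico 0 T := fun t ht => ⟨ht.1, ht.2.trans_lt hτ.2⟩
  have hch := sub_eq_integral_comp_primitive (M := M + M) (c := c) hτ.1.le
    (f := fun s => ut (s, x) - vt (s, x))
    ((hiv hxu.1 τ (Ioo_subset_Ico_self hτ)).sub (hiv hxv.1 τ (Ioo_subset_Ico_self hτ)))
    (fun t ht => by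
      rw [hprim t (hIcc t ht)]
      have hz : (t, x) ∈ Ico 0 T ×ˢ closure Ω := ⟨hIcc t ht, subset_closure hxΩ⟩
      exact (abs_sub _ _).trans (add_le_add (hbd hu _ hz) (hbd hv _ hz)))
    hasDerivAt_max_zero_cube (by fun_prop)
  rw [hprim τ (Ioo_subset_Ico_self hτ), max_eq_right (show c ≤ 0 by linarith),
    zero_pow (by norm_num), sub_zero] at hch
  rw [hch, intervalIntegral.integral_of_le hτ.1.le, ← integral_const_mul]
  refine setIntegral_congr_fun measurableSet_Ioc fun t ht => ?_
  have ht' := hIcc t (Ioc_subset_Icc_self ht)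
  rw [hprim t ht', truncSq_eq hM (hu.sub_le hv ⟨ht', subset_closure hxΩ⟩)]
  ring

/-! ### The comparison principle -/

lemma IsBoundedCandidate.integrable_posPart_pow {p T M K : ℝ} {Ω : Set (Sp N)} (hΩ : IsOpen Ω)
    [IsFiniteMeasure (volume.restrict Ω)] {u v ut vt : ℝ × Sp N → ℝ} {Du Dv : ℝ × Sp N → Sp N}
    (hM : 0 ≤ M)
    (hu : IsBoundedCandidate p Ω T M K u ut Du) (hv : IsBoundedCandidate p Ω T M K v vt Dv)
    (n : ℕ) {t : ℝ} (ht : t ∈ Ico 0 T) :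
    IntegrableOn (fun y => (max (u (t, y) - v (t, y)) 0) ^ n) Ω := by
  have hslice : ∀ {f : ℝ × Sp N → ℝ}, ContinuousOn f (Ico 0 T ×ˢ closure Ω) →
      ContinuousOn (fun y => f (t, y)) Ω := fun hf =>
    hf.comp (by fun_prop) fun y hy => ⟨ht, subset_closure hy⟩
  have hc : ContinuousOn (fun y => (max (u (t, y) - v (t, y)) 0) ^ n) Ω :=
    (((hslice hu.continuousOn).sub (hslice hv.continuousOn)).sup continuousOn_const).pow n
  refine Integrable.of_bound (hc.aestronglyMeasurable hΩ.measurableSet) (M ^ n) ?_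
  refine (ae_restrict_iff' hΩ.measurableSet).2 (Eventually.of_forall fun y hy => ?_)
  rw [Real.norm_eq_abs, abs_of_nonneg (pow_nonneg (le_max_right _ _) _)]
  exact pow_le_pow_left₀ (le_max_right _ _)
    (max_le (hu.sub_le hv ⟨ht, subset_closure hy⟩) hM) n

/-- The difference of the nonlocal integrals is controlled by the integral of the positive part. -/
lemma IsBoundedCandidate.integral_rpow_sub_le {p T M K : ℝ} {Ω : Set (Sp N)} (hΩ : IsOpen Ω)
    [IsFiniteMeasure (volume.restrict Ω)] {u v ut vt : ℝ × Sp N → ℝ} {Du Dv : ℝ × Sp N → Sp N}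
    (hM : 0 ≤ M)
    (hu : IsBoundedCandidate p Ω T M K u ut Du) (hv : IsBoundedCandidate p Ω T M K v vt Dv)
    {s : ℝ} (hs : 1 ≤ s) {t : ℝ} (ht : t ∈ Ico 0 T) :
    (∫ y in Ω, |u (t, y)| ^ s) - ∫ y in Ω, |v (t, y)| ^ s ≤
      s * M ^ (s - 1) * ∫ y in Ω, max (u (t, y) - v (t, y)) 0 := by
  have hs0 : 0 ≤ s := by linarith
  have h1 : IntegrableOn (fun y => max (u (t, y) - v (t, y)) 0) Ω := by
    simpa using hu.integrable_posPart_pow hΩ hM hv 1 ht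
  rw [← integral_sub (hu.integrable_slice hΩ hs0 ht) (hv.integrable_slice hΩ hs0 ht),
    ← integral_const_mul]
  refine setIntegral_mono_on ((hu.integrable_slice hΩ hs0 ht).sub (hv.integrable_slice hΩ hs0 ht))
    (h1.const_mul _) hΩ.measurableSet fun y hy => ?_
  have hy' : (t, y) ∈ Ico 0 T ×ˢ closure Ω := ⟨ht, subset_closure hy⟩
  have hu0 := hu.nonneg _ hy'
  have hv0 := hv.nonneg _ hy'
  rw [abs_of_nonneg hu0, abs_of_nonneg hv0]
  rcases le_total (v (t, y)) (u (t, y)) with h | h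
  · have := abs_rpow_sub_rpow_le hs hu0 hv0 (hu.le _ hy') (hv.le _ hy')
    rw [abs_of_nonneg (sub_nonneg.2 h)] at this
    rw [max_eq_left (sub_nonneg.2 h)]
    exact (le_abs_self _).trans this
  · rw [max_eq_right (sub_nonpos.2 h), mul_zero]
    exact sub_nonpos.2 (Real.rpow_le_rpow hu0 h hs0)

/-- Young's inequality for the product of a power with the integral of the positive part. -/
lemma IsBoundedCandidate.sq_mul_integral_le {p T M K : ℝ} {Ω : Set (Sp N)} (hΩ : IsOpen Ω)
    [IsFiniteMeasure (volume.restrict Ω)] {u v ut vt : ℝ × Sp N → ℝ} {Du Dv : ℝ × Sp N → Sp N}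
    (hM : 0 ≤ M)
    (hu : IsBoundedCandidate p Ω T M K u ut Du) (hv : IsBoundedCandidate p Ω T M K v vt Dv)
    {t : ℝ} (ht : t ∈ Ico 0 T) {a : ℝ} (ha : 0 ≤ a) :
    a ^ 2 * ∫ y in Ω, max (u (t, y) - v (t, y)) 0 ≤
      volume.real Ω * a ^ 3 + ∫ y in Ω, (max (u (t, y) - v (t, y)) 0) ^ 3 := by
  have h1 : IntegrableOn (fun y => max (u (t, y) - v (t, y)) 0) Ω := by
    simpa using hu.integrable_posPart_pow hΩ hM hv 1 ht
  have h3 := hu.integrable_posPart_pow hΩ hM hv 3 ht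
  have hconst : volume.real Ω * a ^ 3 = ∫ y in Ω, a ^ 3 := by simp
  rw [← integral_const_mul, hconst, ← integral_add (integrable_const _) h3]
  refine integral_mono (h1.const_mul _) ((integrable_const _).add h3) fun y => ?_
  have hb : 0 ≤ max (u (t, y) - v (t, y)) 0 := le_max_right _ _
  simp only
  generalize max (u (t, y) - v (t, y)) 0 = b at hb ⊢
  rcases le_total b a with h | h
  · nlinarith [mul_le_mul_of_nonneg_left h (sq_nonneg a), pow_nonneg hb 3]
  · nlinarith [mul_le_mul_of_nonneg_right (pow_le_pow_left₀ ha h 2) hb, pow_nonneg ha 3]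

/-- Pointwise form of the comparison estimate: after testing with the square of the positive part,
the diffusion absorbs the gradient terms, and the remaining terms are of the order of the energy. -/
lemma IsBoundedCandidate.exists_le_testResidual_sub (P : Params)
    (hα : 0 < P.α) (hl : 0 < P.l) (hσ : 0 < P.σ) (hβ : 0 ≤ P.β) (hν : 0 ≤ P.ν)
    (hr : P.p - 1 ≤ P.r) (hp : P.p / 2 ≤ P.p - 1) (hq : P.p / 2 ≤ P.q)
    (hk : 1 ≤ P.k) (hm : 1 ≤ P.m) (hs : 1 ≤ P.s) {T M K : ℝ} (hM : 0 ≤ M) (hK : 0 ≤ K)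
    {Ω : Set (Sp N)} (hΩ : IsOpen Ω)
    [IsFiniteMeasure (volume.restrict Ω)] {u v ut vt : ℝ × Sp N → ℝ} {Du Dv : ℝ × Sp N → Sp N}
    (hu : IsBoundedCandidate P.p Ω T M K u ut Du)
    (hv : IsBoundedCandidate P.p Ω T M K v vt Dv) :
    ∃ C, 0 ≤ C ∧ ∀ᵐ z ∂(volume.restrict (Cyl Ω T)),
      (ut z - vt z) * truncSq M (u z - v z) - C * ((max (u z - v z) 0) ^ 3 +
          ∫ y in Ω, (max (u (z.1, y) - v (z.1, y)) 0) ^ 3) ≤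
        testResidual P Ω u ut Du (fun z => truncSq M (u z - v z))
            (fun z => truncPos M (u z - v z)) (fun z => Du z - Dv z) z -
          testResidual P Ω v vt Dv (fun z => truncSq M (u z - v z))
            (fun z => truncPos M (u z - v z)) (fun z => Du z - Dv z) z := by
  have hp2 : 2 ≤ P.p := by linarith
  have hs0 : 0 ≤ P.s := by linarith
  set B := max (volume.real Ω * M ^ P.s) (P.s * M ^ (P.s - 1)) with hB
  have hB0 : 0 ≤ B := le_max_of_le_left (by positivity)
  obtain ⟨C₀, hC₀, hreac⟩ :=
    P.exists_reaction_sub_le hα hl hσ hβ hν hr hp hq hk hm hM hK hB0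
  set C := C₀ + C₀ * volume.real Ω + C₀ ^ 2 * P.p / 16 with hC
  have hCC : C₀ ≤ C := by
    have : 0 ≤ C₀ * volume.real Ω := by positivity
    have : 0 ≤ C₀ ^ 2 * P.p / 16 := by positivity
    linarith
  refine ⟨C, hC₀.trans hCC, ?_⟩
  filter_upwards [hu.norm_grad_le, hv.norm_grad_le,
    ae_restrict_mem (isOpen_Ioo.prod hΩ).measurableSet] with z hKu hKv hz
  have hz' := cyl_subset Ω T hz
  have ht : z.1 ∈ Ico 0 T := hz'.1
  have hw := hu.sub_le hv hz'
  set Y := ∫ y in Ω, (max (u (z.1, y) - v (z.1, y)) 0) ^ 3 with hY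
  have hY0 : 0 ≤ Y := integral_nonneg fun y => pow_nonneg (le_max_right _ _) 3
  simp only [testResidual]
  rw [truncSq_eq hM hw, truncPos_eq (max_le hw hM)]
  rcases le_total (u z) (v z) with h | h
  · rw [max_eq_right (sub_nonpos.2 h)]
    have : 0 ≤ C * Y := mul_nonneg (hC₀.trans hCC) hY0
    norm_num
    linarith
  · rw [max_eq_left (sub_nonneg.2 h)]
    set w := u z - v z with hwdef
    have hw0 : 0 ≤ w := sub_nonneg.2 h
    set I := ∫ y in Ω, max (u (z.1, y) - v (z.1, y)) 0 with hI
    have hI0 : 0 ≤ I := integral_nonneg fun y => le_max_right _ _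
    have r1 : rhs P Ω u Du z - rhs P Ω v Dv z ≤ C₀ * w + C₀ * I +
        C₀ * |‖Du z‖ ^ (P.p / 2) - ‖Dv z‖ ^ (P.p / 2)| := by
      refine hreac (u z) (v z) ‖Du z‖ ‖Dv z‖ _ _ I (hv.nonneg z hz') h (hu.le z hz')
        (norm_nonneg _) hKu (norm_nonneg _) hKv (integral_nonneg fun y => by positivity)
        ((hu.integral_slice_le hΩ hs0 ht).trans (le_max_left _ _)) ?_ hI0
      exact (hu.integral_rpow_sub_le hΩ hM hv hs ht).trans
        (mul_le_mul_of_nonneg_right (le_max_right _ _) hI0)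
    have r2 := hu.sq_mul_integral_le hΩ hM hv ht hw0
    have r3 := flux_monotone hp2 (Du z) (Dv z)
    rw [← sq_abs] at r3
    have r4 := absorb_gradient (C := C₀) (by linarith : 0 < P.p) hw0 r3
    have r5 := mul_le_mul_of_nonneg_right r1 (sq_nonneg w)
    have r6 := mul_le_mul_of_nonneg_left r2 hC₀
    have r7 : C₀ * Y ≤ C * Y := mul_le_mul_of_nonneg_right hCC hY0
    have r8 : C * w ^ 3 = C₀ * w ^ 3 + C₀ * volume.real Ω * w ^ 3 + C₀ ^ 2 * P.p / 16 * w ^ 3 := by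
      rw [hC]; ring
    linarith

/-- The cubic energy of the positive part of `u - v` vanishes at all times. -/
lemma IsBoundedCandidate.integral_posPart_cube_eq_zero (P : Params)
    (hα : 0 < P.α) (hl : 0 < P.l) (hσ : 0 < P.σ) (hβ : 0 ≤ P.β) (hν : 0 ≤ P.ν)
    (hr : P.p - 1 ≤ P.r) (hp : P.p / 2 ≤ P.p - 1) (hq : P.p / 2 ≤ P.q)
    (hk : 1 ≤ P.k) (hm : 1 ≤ P.m) (hs : 1 ≤ P.s) {T M K : ℝ} (hT : 0 < T) (hM : 0 ≤ M)
    (hK : 0 ≤ K) {Ω : Set (Sp N)} (hΩ : IsOpen Ω)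
    [IsFiniteMeasure (volume.restrict Ω)] {u v ut vt : ℝ × Sp N → ℝ} {Du Dv : ℝ × Sp N → Sp N}
    (hu : IsBoundedCandidate P.p Ω T M K u ut Du)
    (hv : IsBoundedCandidate P.p Ω T M K v vt Dv)
    (h0 : ∀ᵐ x ∂(volume.restrict Ω), u (0, x) ≤ v (0, x))
    (hsub : ∀ (φ : ℝ × Sp N → ℝ) (Dφ : ℝ × Sp N → Sp N), IsAdmissible P.p Ω T φ Dφ →
      (∫ z in Cyl Ω T, (ut z * φ z + ‖Du z‖ ^ (P.p - 2) * inner ℝ (Du z) (Dφ z))) ≤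
        ∫ z in Cyl Ω T, rhs P Ω u Du z * φ z)
    (hsup : ∀ (φ : ℝ × Sp N → ℝ) (Dφ : ℝ × Sp N → Sp N), IsAdmissible P.p Ω T φ Dφ →
      (∫ z in Cyl Ω T, rhs P Ω v Dv z * φ z) ≤
        ∫ z in Cyl Ω T, (vt z * φ z + ‖Dv z‖ ^ (P.p - 2) * inner ℝ (Dv z) (Dφ z))) :
    ∀ t ∈ Ioo 0 T, ∫ x in Ω, (max (u (t, x) - v (t, x)) 0) ^ 3 = 0 := by
  have := isFiniteMeasure_cyl Ω T
  have hp2 : 2 ≤ P.p := by linarith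
  have hcm : MeasurableSet (Cyl Ω T) := (isOpen_Ioo.prod hΩ).measurableSet
  set w : ℝ × Sp N → ℝ := fun z => u z - v z with hw
  set V : ℝ × Sp N → Sp N := fun z => Du z - Dv z with hV
  set g : ℝ × Sp N → ℝ := fun z => truncSq M (w z) with hg
  set k : ℝ × Sp N → ℝ := fun z => truncPos M (w z) with hkdef
  set Y : ℝ → ℝ := fun t => ∫ x in Ω, (max (u (t, x) - v (t, x)) 0) ^ 3 with hY
  have hwm : AEStronglyMeasurable w (volume.restrict (Cyl Ω T)) :=
    hu.memLaW10.memLp.1.sub hv.memLaW10.memLp.1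
  have hgm : AEStronglyMeasurable g (volume.restrict (Cyl Ω T)) :=
    (continuous_truncSq M).comp_aestronglyMeasurable hwm
  have hkm : AEStronglyMeasurable k (volume.restrict (Cyl Ω T)) :=
    (continuous_truncPos M).comp_aestronglyMeasurable hwm
  have hVm : AEStronglyMeasurable V (volume.restrict (Cyl Ω T)) :=
    hu.memLaW10.memLp_grad.1.sub hv.memLaW10.memLp_grad.1
  have hmax : ∀ z ∈ Ico 0 T ×ˢ closure Ω, max (w z) 0 ≤ M := fun z hz =>
    max_le (hu.sub_le hv hz) hM
  set C := max (M ^ 2) (max (2 * M) (K + K)) with hC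
  have hgC : ∀ z ∈ Cyl Ω T, |g z| ≤ C := fun z hz => by
    have hz' := cyl_subset Ω T hz
    change |truncSq M (u z - v z)| ≤ C
    rw [truncSq_eq hM (hu.sub_le hv hz'), abs_of_nonneg (sq_nonneg _)]
    exact (pow_le_pow_left₀ (le_max_right _ _) (hmax z hz') 2).trans (le_max_left _ _)
  have hkC : ∀ z ∈ Cyl Ω T, |k z| ≤ C := fun z _ =>
    (abs_truncPos_le hM _).trans ((le_max_left _ _).trans (le_max_right _ _))
  have hVC : ∀ᵐ z ∂(volume.restrict (Cyl Ω T)), ‖V z‖ ≤ C := by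
    filter_upwards [hu.norm_grad_le, hv.norm_grad_le] with z h1 h2
    exact ((norm_sub_le _ _).trans (add_le_add h1 h2)).trans
      ((le_max_right _ _).trans (le_max_right _ _))
  have hq0 : 0 ≤ P.q := by linarith
  have hr0 : 0 ≤ P.r := by linarith
  have hk0 : 0 < P.k := by linarith
  have hm0 : 0 ≤ P.m := by linarith
  have hs0 : 0 ≤ P.s := by linarith
  obtain ⟨a1, a2, a3⟩ := hu.integrable_terms hl hσ hp2 hq0 hr0 hk0 hm0 hs0 hΩ hgm hkm hVm
    hgC hkC hVC
  obtain ⟨b1, b2, b3⟩ := hv.integrable_terms hl hσ hp2 hq0 hr0 hk0 hm0 hs0 hΩ hgm hkm hVm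
    hgC hkC hVC
  set Eu := testResidual P Ω u ut Du g k V with hEu
  set Ev := testResidual P Ω v vt Dv g k V with hEv
  have iEu : IntegrableOn Eu (Cyl Ω T) := (a1.add a2).sub a3
  have iEv : IntegrableOn Ev (Cyl Ω T) := (b1.add b2).sub b3
  have hcut : ∀ (χ : ℝ → ℝ) (τ' : ℝ), Continuous χ → (∀ t, 0 ≤ χ t) → (∀ t, χ t ≤ 1) → τ' < T →
      (∀ t, τ' ≤ t → χ t = 0) → ∫ z in Cyl Ω T, χ z.1 * (Eu z - Ev z) ≤ 0 := by
    intro χ τ' hχ hχ0 hχ1 hτ' hχτ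
    have hχ' : ∀ t, |χ t| ≤ 1 := fun t => by rw [abs_of_nonneg (hχ0 t)]; exact hχ1 t
    have hadm := hu.isAdmissible (by linarith) hM hv hχ hχ0 hχ1 hτ' hχτ
    have e1 := hu.sub_eq_integral_testResidual hl hσ hp2 hq0 hr0 hk0 hm0 hs0 hΩ hgm hkm hVm
      hgC hkC hVC hχ hχ'
    have e2 := hv.sub_eq_integral_testResidual hl hσ hp2 hq0 hr0 hk0 hm0 hs0 hΩ hgm hkm hVm
      hgC hkC hVC hχ hχ'
    have s1 := hsub _ _ hadm
    have s2 := hsup _ _ hadm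
    have hχm : AEStronglyMeasurable (fun z : ℝ × Sp N => χ z.1) (volume.restrict (Cyl Ω T)) :=
      (hχ.comp continuous_fst).aestronglyMeasurable
    have j1 := Integrable.bdd_mul iEu hχm (Eventually.of_forall fun z => hχ' z.1)
    have j2 := Integrable.bdd_mul iEv hχm (Eventually.of_forall fun z => hχ' z.1)
    simp only [mul_sub]
    rw [integral_sub j1 j2]
    linarith
  obtain ⟨C', hC'0, hpt⟩ :=
    hu.exists_le_testResidual_sub P hα hl hσ hβ hν hr hp hq hk hm hs hM hK hΩ hv
  have hY0 : ∀ t, 0 ≤ Y t := fun t => integral_nonneg fun x => pow_nonneg (le_max_right _ _) 3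
  have hYB : ∀ t ∈ Ico 0 T, Y t ≤ volume.real Ω * M ^ 3 := fun t ht => by
    have h : Y t ≤ ∫ x in Ω, M ^ 3 :=
      setIntegral_mono_on (hu.integrable_posPart_pow hΩ hM hv 3 ht) (integrable_const _)
        hΩ.measurableSet fun x hx =>
        pow_le_pow_left₀ (le_max_right _ _) (hmax (t, x) ⟨ht, subset_closure hx⟩) 3
    simpa using h
  have hcube : IntegrableOn (fun z => (max (w z) 0) ^ 3) (Cyl Ω T) := by
    refine Integrable.of_bound (((continuous_id.max continuous_const).pow
      3).comp_aestronglyMeasurable hwm) (M ^ 3) ((ae_restrict_iff' hcm).2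
      (Eventually.of_forall fun z hz => ?_))
    rw [Real.norm_eq_abs, abs_of_nonneg (pow_nonneg (le_max_right _ _) 3)]
    exact pow_le_pow_left₀ (le_max_right _ _) (hmax z (cyl_subset Ω T hz)) 3
  have hYm : AEStronglyMeasurable Y (volume.restrict (Ioo 0 T)) :=
    aestronglyMeasurable_integral_slice hcube.1
  have hYi : IntegrableOn Y (Ioo 0 T) :=
    Integrable.of_bound hYm (volume.real Ω * M ^ 3) ((ae_restrict_iff' measurableSet_Ioo).2
      (Eventually.of_forall fun t ht => by
        rw [Real.norm_eq_abs, abs_of_nonneg (hY0 t)]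
        exact hYB t (Ioo_subset_Ico_self ht)))
  refine eq_zero_of_le_integral (C := 3 * (C' * (1 + volume.real Ω))) (by positivity)
    (fun t _ => hY0 t) (fun t ht => hYB t (Ioo_subset_Ico_self ht)) hYi fun τ hτ => ?_
  have hsubτ : Ioc 0 τ ×ˢ Ω ⊆ Cyl Ω T :=
    prod_mono (fun t ht => ⟨ht.1, ht.2.trans_lt hτ.2⟩) le_rfl
  have hsubτ' : Ioc 0 τ ⊆ Ioo 0 T := fun t ht => ⟨ht.1, ht.2.trans_lt hτ.2⟩
  have hrestr : (volume : Measure (ℝ × Sp N)).restrict (Ioc 0 τ ×ˢ Ω) =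
      (volume.restrict (Ioc 0 τ)).prod (volume.restrict Ω) := by
    rw [Measure.prod_restrict]; rfl
  have k1 : IntegrableOn (fun z => (max (w z) 0) ^ 3) (Ioc 0 τ ×ˢ Ω) := hcube.mono_set hsubτ
  have k2 : IntegrableOn (fun z : ℝ × Sp N => Y z.1) (Ioc 0 τ ×ˢ Ω) := by
    rw [IntegrableOn, hrestr]
    exact (hYi.mono_set hsubτ').comp_fst _
  have k3 : IntegrableOn (fun z => (ut z - vt z) * g z) (Ioc 0 τ ×ˢ Ω) := by
    refine IntegrableOn.mono_set ?_ hsubτ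
    exact Integrable.mul_bdd (hu.integrable_timeDeriv.sub hv.integrable_timeDeriv) hgm
      ((ae_restrict_iff' hcm).2 (Eventually.of_forall hgC))
  have l1 : ∫ z in Ioc 0 τ ×ˢ Ω, (max (w z) 0) ^ 3 = ∫ t in (0 : ℝ)..τ, Y t := by
    rw [IntegrableOn, hrestr] at k1
    rw [hrestr, integral_prod _ k1, intervalIntegral.integral_of_le hτ.1.le]
  have l2 : ∫ z in Ioc 0 τ ×ˢ Ω, Y z.1 = volume.real Ω * ∫ t in (0 : ℝ)..τ, Y t := by
    rw [IntegrableOn, hrestr] at k2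
    rw [hrestr, integral_prod _ k2, intervalIntegral.integral_of_le hτ.1.le,
      ← integral_const_mul]
    simp
  have l3 := hu.integral_timeDeriv_mul hT hM hΩ hv h0 hτ
  have l4 := setIntegral_nonpos_of_cutoff hτ (iEu.sub iEv) hcut
  have l5 : ∫ z in Ioc 0 τ ×ˢ Ω, ((ut z - vt z) * g z - C' * ((max (w z) 0) ^ 3 + Y z.1)) ≤
      ∫ z in Ioc 0 τ ×ˢ Ω, (Eu z - Ev z) :=
    integral_mono_ae (k3.sub ((k1.add k2).const_mul C')) ((iEu.sub iEv).mono_set hsubτ)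
      (ae_restrict_of_ae_restrict_of_subset hsubτ hpt)
  have l6 : ∫ z in Ioc 0 τ ×ˢ Ω, ((ut z - vt z) * g z - C' * ((max (w z) 0) ^ 3 + Y z.1)) =
      3⁻¹ * Y τ - C' * ((∫ t in (0 : ℝ)..τ, Y t) + volume.real Ω * ∫ t in (0 : ℝ)..τ, Y t) := by
    rw [← l2, ← l1, ← integral_add k1 k2, ← l3, ← integral_const_mul]
    exact integral_sub k3 ((k1.add k2).const_mul C')
  have l7 : ∫ z in Ioc 0 τ ×ˢ Ω, (Eu z - Ev z) ≤ 0 := l4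
  linarith

end PLap

theorem theorem2p1 (N : ℕ) (hN : 1 ≤ N) (Ω : Set (PLap.Sp N))
    (hΩ : PLap.IsSmoothBoundedDomain Ω) (T : ℝ) (hT : 0 < T) (P : PLap.Params)
    (hα : 0 < P.α) (hl : 0 < P.l) (hσ : 0 < P.σ) (hβ : 0 ≤ P.β) (hν : 0 ≤ P.ν)
    (hr : P.p - 1 ≤ P.r) (hp : P.p / 2 ≤ P.p - 1) (hq : P.p / 2 ≤ P.q)
    (hk : 1 ≤ P.k) (hm : 1 ≤ P.m) (hs : 1 ≤ P.s)
    (u₀ : PLap.Sp N → ℝ) (hu₀ : PLap.IsInitialDatum Ω u₀)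
    (u v : ℝ × PLap.Sp N → ℝ)
    (hu : PLap.IsWeakSub P Ω T u₀ u) (hv : PLap.IsWeakSuper P Ω T u₀ v)
    (hu_inf : ∃ Du : ℝ × PLap.Sp N → PLap.Sp N, PLap.MemLaW10 Ω T ⊤ u Du)
    (hv_inf : ∃ Dv : ℝ × PLap.Sp N → PLap.Sp N, PLap.MemLaW10 Ω T ⊤ v Dv)
    (hu_loc : PLap.IsLocallyBounded Ω T u) (hv_loc : PLap.IsLocallyBounded Ω T v) :
    (∀ t ∈ Ioo 0 T, ∀ᵐ x ∂(volume.restrict Ω), u (t, x) ≤ v (t, x)) ∧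
      (∀ᵐ z ∂(volume.restrict (PLap.Cyl Ω T)), u z ≤ v z) := by
  have hfin : IsFiniteMeasure (volume.restrict Ω) :=
    isFiniteMeasure_restrict.2 hΩ.isBounded.measure_lt_top.ne
  have hp2 : 2 ≤ P.p := by linarith
  obtain ⟨M₁, K₁, Du, ut, hcu, hsub⟩ :=
    PLap.IsWeak.exists_isBoundedCandidate hΩ.isOpen hp2 hu hu_inf
  obtain ⟨M₂, K₂, Dv, vt, hcv, hsup⟩ :=
    PLap.IsWeak.exists_isBoundedCandidate hΩ.isOpen hp2 hv hv_inf
  have hcu' := hcu (max 0 (max M₁ M₂)) (max 0 (max K₁ K₂))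
    ((le_max_left _ _).trans (le_max_right _ _)) ((le_max_left _ _).trans (le_max_right _ _))
  have hcv' := hcv (max 0 (max M₁ M₂)) (max 0 (max K₁ K₂))
    ((le_max_right _ _).trans (le_max_right _ _)) ((le_max_right _ _).trans (le_max_right _ _))
  have h0 : ∀ᵐ x ∂(volume.restrict Ω), u (0, x) ≤ v (0, x) := by
    filter_upwards [hu.initial, hv.initial] with x h1 h2 using h1.trans h2
  have hY := hcu'.integral_posPart_cube_eq_zero P hα hl hσ hβ hν hr hp hq hk hm hs hT
    (le_max_left _ _) (le_max_left _ _) hΩ.isOpen hcv' h0 hsub hsup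
  have hmain : ∀ t ∈ Ioo 0 T, ∀ᵐ x ∂(volume.restrict Ω), u (t, x) ≤ v (t, x) := by
    intro t ht
    have hz := (integral_eq_zero_iff_of_nonneg (fun x => pow_nonneg (le_max_right _ _) 3)
      (hcu'.integrable_posPart_pow hΩ.isOpen (le_max_left _ _) hcv' 3
        (Ioo_subset_Ico_self ht))).1 (hY t ht)
    filter_upwards [hz] with x hx
    have hx' := max_eq_right_iff.1 (pow_eq_zero_iff (by norm_num) |>.1 hx)
    linarith
  refine ⟨hmain, ?_⟩
  -- continuity of the slices upgrades the inequality to every point of the cylinder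
  refine (ae_restrict_iff' (isOpen_Ioo.prod hΩ.isOpen).measurableSet).2
    (Eventually.of_forall fun z hz => ?_)
  have hslice : ∀ {f : ℝ × PLap.Sp N → ℝ}, ContinuousOn f (Ico 0 T ×ˢ closure Ω) →
      ContinuousOn (fun y => f (z.1, y)) Ω := fun hf =>
    hf.comp (by fun_prop) fun y hy => ⟨Ioo_subset_Ico_self hz.1, subset_closure hy⟩
  have heq : EqOn (fun y => min (u (z.1, y)) (v (z.1, y))) (fun y => u (z.1, y)) Ω := by
    refine Measure.eqOn_open_of_ae_eq (μ := volume) ?_ hΩ.isOpen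
      ((hslice hu.continuousOn).inf (hslice hv.continuousOn)) (hslice hu.continuousOn)
    filter_upwards [hmain z.1 hz.1] with y hy using min_eq_left hy
  exact min_eq_left_iff.1 (heq hz.2)
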